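/- An operator system is a complex $*$-vector space $\mathcal S$ with cones $M_n(\mathcal S)^+\subseteq M_n(\mathcal S)_h$ ($n\in\mathbb N$) satisfying $M_n(\mathcal S)^+\cap(-M_n(\mathcal S)^+)=\{0\}$ and $\alpha M_n(\mathcal S)^+\alpha^*\subseteq M_m(\mathcal S)^+$ for all $\alpha\in M_{m,n}(\mathbb C)$, and with an Archimedean matrix order unit $1_{\mathcal S}$. Its norm is $\|x\|=\inf\{r\ge 0:\begin{pmatrix} r1_{\mathcal S}&x\\x^*&r1_{\mathcal S}\end{pmatrix}\in M_2(\mathcal S)^+\}$. The matrix algebra $M_k=M_k(\mathbb C)$ is an operator system with its usual matrix order. For operator systems $\mathcal S,\mathcal T$, the minimal and the maximal operator system tensor products $\mathcal S\otimes_{\min}\mathcal T$ and $\mathcal S\otimes_{\max}\mathcal T$ are the $*$-vector space $\mathcal S\otimes\mathcal T$ (algebraic tensor product) with unit $1_{\mathcal S}\otimes 1_{\mathcal T}$ and the following cones: - $M_n(\mathcal S\otimes_{\min}\mathcal T)^+$ is the set of all $[p_{ij}]\in M_n(\mathcal S\otimes\mathcal T)$ such that $[(\varphi\otimes\psi)(p_{ij})]\in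 M_{nkm}^+$ for all $k,m$ and all unital completely positive maps $\varphi:\mathcal S\to M_k$, $\psi:\mathcal T\to M_m$; - $M_n(\mathcal S\otimes_{\max}\mathcal T)^+$ is the set of all $X\in M_n(\mathcal S\otimes\mathcal T)$ such that, for every $\varepsilon>0$, $X+\varepsilon I_n\otimes 1_{\mathcal S}\otimes 1_{\mathcal T}=\alpha(P\otimes Q)\alpha^*$ for some $k,l$, $P\in M_k(\mathcal S)^+$, $Q\in M_l(\mathcal T)^+$ and $\alpha\in M_{n,kl}(\mathbb C)$. We write $\mathcal S\otimes_{\min}\mathcal T=\mathcal S\otimes_{\max}\mathcal T$ if these cones coincide for every $n$. The operator system $\mathcal S$ is called nuclear if $\mathcal S\otimes_{\min}\mathcal T=\mathcal S\otimes_{\max}\mathcal T$ for every operator system $\mathcal T$. **Corollary.** Let $\mathcal S$ be an operator system. The following are equivalent: 1. $\mathcal S$ is nuclear; 2. $E\otimes_{\min}\mathcal S=E\otimes_{\max}\mathcal S$ for every finite-dimensional operator system $E$; 3. there exist nets of unital completely positive maps $\varphi_\lambda:\mathcal S\to M_{n_\lambda}$ and $\psi_\lambda:M_{n_\lambda}\to\mathcal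 S$ such that $\psi_\lambda\circ\varphi_\lambda$ converges to $\mathrm{id}_{\mathcal S}$ in the point-norm topology, i.e. $\|\psi_\lambda(\varphi_\lambda(x))-x\|\to 0$ for every $x\in\mathcal S$. -/

import Mathlib

open scoped TensorProduct Kronecker Topology ComplexOrder

universe u v w

/-- The matrix `α X α*`, for a scalar matrix `α` and a matrix `X` over a complex vector space. -/
def matConj {V : Type*} [AddCommGroup V] [Module ℂ V] {ι κ : Type*} [Fintype κ]
    (α : Matrix ι κ ℂ) (X : Matrix κ κ V) : Matrix ι ι V :=
  fun i j => ∑ k, ∑ l, (α i k * star (α j l)) • X k l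

/-- An (abstract) operator system, in the sense of Choi and Effros: a complex `*`-vector space `S`
with a proper matrix ordering, that is a family of cones `Mₙ(S)⁺ ⊆ Mₙ(S)ₕ`, and an Archimedean
matrix order unit. -/
class OperatorSystem (S : Type u) [AddCommGroup S] [Module ℂ S] [StarAddMonoid S]
    [StarModule ℂ S] where
  /-- the cone `Mₙ(S)⁺` of positive elements of `Mₙ(S)` -/
  cone : (n : ℕ) → Set (Matrix (Fin n) (Fin n) S)
  /-- the unit `1` of `S` -/
  unit : S
  cone_isHermitian : ∀ {n : ℕ} {X : Matrix (Fin n) (Fin n) S}, X ∈ cone n → X.conjTranspose = X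
  zero_mem : ∀ n : ℕ, (0 : Matrix (Fin n) (Fin n) S) ∈ cone n
  add_mem : ∀ {n : ℕ} {X Y : Matrix (Fin n) (Fin n) S}, X ∈ cone n → Y ∈ cone n → X + Y ∈ cone n
  smul_mem : ∀ {n : ℕ} {X : Matrix (Fin n) (Fin n) S} {r : ℝ}, 0 ≤ r → X ∈ cone n →
    (r : ℂ) • X ∈ cone n
  /-- the cones are proper: `Mₙ(S)⁺ ∩ -Mₙ(S)⁺ = 0` -/
  proper : ∀ {n : ℕ} {X : Matrix (Fin n) (Fin n) S}, X ∈ cone n → -X ∈ cone n → X = 0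
  /-- compatibility of the cones: `α Mₙ(S)⁺ α* ⊆ Mₘ(S)⁺` for every scalar `m × n` matrix `α` -/
  conj_mem : ∀ {m n : ℕ} (α : Matrix (Fin m) (Fin n) ℂ) {X : Matrix (Fin n) (Fin n) S},
    X ∈ cone n → matConj α X ∈ cone m
  star_unit : star unit = unit
  /-- `Iₙ ⊗ 1` is an order unit of `Mₙ(S)` -/
  orderUnit : ∀ {n : ℕ} {X : Matrix (Fin n) (Fin n) S}, X.conjTranspose = X →
    ∃ r : ℝ, 0 < r ∧ Matrix.diagonal (fun _ : Fin n => (r : ℂ) • unit) - X ∈ cone n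
  /-- `Iₙ ⊗ 1` is Archimedean -/
  archimedean : ∀ {n : ℕ} {X : Matrix (Fin n) (Fin n) S},
    (∀ r : ℝ, 0 < r → Matrix.diagonal (fun _ : Fin n => (r : ℂ) • unit) + X ∈ cone n) → X ∈ cone n

namespace OperatorSystem

section Maps

variable {S : Type u} [AddCommGroup S] [Module ℂ S] [StarAddMonoid S] [StarModule ℂ S]
  [OperatorSystem S]
variable {T : Type v} [AddCommGroup T] [Module ℂ T] [StarAddMonoid T] [StarModule ℂ T]
  [OperatorSystem T]

/-- Unital completely positive maps. -/
structure IsUCP (φ : S →ₗ[ℂ] T) : Prop where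
  map_unit : φ unit = unit
  map_cone : ∀ (n : ℕ) (X : Matrix (Fin n) (Fin n) S), X ∈ cone n → X.map φ ∈ cone n

/-- The norm that the unit and the matrix order of an operator system determine:
`‖x‖` is the infimum of all `r ≥ 0` for which the matrix with rows `r1, x` and `x*, r1` is
positive in `M₂(S)`. -/
noncomputable def osNorm (x : S) : ℝ :=
  sInf {r : ℝ | 0 ≤ r ∧ !![(r : ℂ) • (unit : S), x; star x, (r : ℂ) • (unit : S)] ∈ cone 2}

end Maps

section Matrices

open scoped Matrix.Norms.L2Operator MatrixOrder in
/-- A Hermitian complex matrix is bounded above by a multiple of the identity. -/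
theorem exists_smul_one_sub_posSemidef {ι : Type*} [Fintype ι] [DecidableEq ι]
    {H : Matrix ι ι ℂ} (hH : H.IsHermitian) :
    ∃ r : ℝ, 0 < r ∧ ((r : ℂ) • (1 : Matrix ι ι ℂ) - H).PosSemidef := by
  obtain ⟨r, hr, h⟩ : ∃ r : ℝ, 0 < r ∧ H ≤ algebraMap ℝ _ r := by
    refine ⟨‖H‖ + 1, by positivity, ?_⟩
    refine (IsSelfAdjoint.le_algebraMap_norm_self hH).trans ?_
    rw [map_add]
    exact le_add_of_nonneg_right (by rw [map_one]; exact zero_le_one)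
  have e : algebraMap ℝ (Matrix ι ι ℂ) r = (r : ℂ) • 1 := by
    ext i j
    by_cases hij : i = j <;> simp [Matrix.algebraMap_matrix_apply, hij]
  rw [Matrix.le_iff, e] at h
  exact ⟨r, hr, h⟩

/-- A complex matrix that is positive semidefinite after adding any positive multiple of the
identity is positive semidefinite. -/
theorem posSemidef_of_forall_smul_one_add {ι : Type*} [Fintype ι] [DecidableEq ι]
    {H : Matrix ι ι ℂ}
    (h : ∀ r : ℝ, 0 < r → ((r : ℂ) • (1 : Matrix ι ι ℂ) + H).PosSemidef) : H.PosSemidef := by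
  have key : ∀ (r : ℝ) (x : ι → ℂ), star x ⬝ᵥ (((r : ℂ) • (1 : Matrix ι ι ℂ) + H).mulVec x) =
      r * (star x ⬝ᵥ x) + star x ⬝ᵥ (H.mulVec x) := by
    intro r x
    simp [Matrix.add_mulVec, Matrix.smul_mulVec, dotProduct_add]
  refine Matrix.PosSemidef.of_dotProduct_mulVec_nonneg ?_ fun x => ?_
  · have h1 := (h 1 one_pos).isHermitian
    simpa using h1.sub (Matrix.isHermitian_one (n := ι) (α := ℂ))
  · have hc : Filter.Tendsto (fun r : ℝ => (r : ℂ) * (star x ⬝ᵥ x) + star x ⬝ᵥ (H.mulVec x))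
        (𝓝[>] 0) (𝓝 (((0 : ℝ) : ℂ) * (star x ⬝ᵥ x) + star x ⬝ᵥ (H.mulVec x))) := by
      refine Filter.Tendsto.mono_left (Continuous.tendsto ?_ 0) nhdsWithin_le_nhds
      fun_prop
    have := ge_of_tendsto (b := (0 : ℂ)) hc ?_
    · simpa using this
    · filter_upwards [self_mem_nhdsWithin] with r hr
      rw [← key]
      exact (h r hr).dotProduct_mulVec_nonneg x

theorem comp_diagonal_smul_one (n k : ℕ) (r : ℂ) :
    Matrix.comp (Fin n) (Fin n) (Fin k) (Fin k) ℂ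
      (Matrix.diagonal fun _ => r • (1 : Matrix (Fin k) (Fin k) ℂ)) = r • 1 := by
  ext ⟨i, a⟩ ⟨j, b⟩
  by_cases hij : i = j <;> simp [Matrix.one_apply, hij]

theorem comp_matConj {m n k : ℕ} (α : Matrix (Fin m) (Fin n) ℂ)
    (X : Matrix (Fin n) (Fin n) (Matrix (Fin k) (Fin k) ℂ)) :
    Matrix.comp _ _ _ _ ℂ (matConj α X) =
      (α ⊗ₖ (1 : Matrix (Fin k) (Fin k) ℂ)) * Matrix.comp _ _ _ _ ℂ X *
        (α ⊗ₖ (1 : Matrix (Fin k) (Fin k) ℂ)).conjTranspose := by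
  ext ⟨i, a⟩ ⟨j, b⟩
  simp only [matConj, Matrix.comp_apply, Matrix.mul_apply, Fintype.sum_prod_type,
    Matrix.sum_apply, Matrix.smul_apply, Matrix.conjTranspose_apply, Matrix.kroneckerMap_apply,
    Matrix.one_apply, smul_eq_mul]
  simp only [mul_ite, mul_one, mul_zero, ite_mul, zero_mul, Finset.sum_ite_eq, Finset.mem_univ,
    if_true, Finset.sum_mul, apply_ite star, star_zero]
  rw [Finset.sum_comm]
  refine Finset.sum_congr rfl fun _ _ => Finset.sum_congr rfl fun _ _ => ?_
  ring

open scoped MatrixOrder in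
/-- The operator system `M_k` of complex `k × k` matrices: an element of `Mₙ(M_k) = M_{nk}` is
positive if it is a positive semidefinite `nk × nk` matrix. -/
instance instMatrix (k : ℕ) : OperatorSystem (Matrix (Fin k) (Fin k) ℂ) where
  cone n := {X | (Matrix.comp (Fin n) (Fin n) (Fin k) (Fin k) ℂ X).PosSemidef}
  unit := 1
  cone_isHermitian {n X} h := by
    ext i j a b
    exact congrFun (congrFun h.1 (i, a)) (j, b)
  zero_mem n := Matrix.PosSemidef.zero
  add_mem h₁ h₂ := h₁.add h₂
  smul_mem {n X r} hr h := by
    exact Matrix.PosSemidef.smul (a := (r : ℂ)) h (by exact_mod_cast hr)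
  proper {n X} h₁ h₂ := by
    have h₃ : (-Matrix.comp (Fin n) (Fin n) (Fin k) (Fin k) ℂ X).PosSemidef := h₂
    have h₄ : Matrix.comp (Fin n) (Fin n) (Fin k) (Fin k) ℂ X = 0 :=
      le_antisymm (by simpa [Matrix.le_iff] using h₃)
        (by simpa [Matrix.le_iff] using (show Matrix.PosSemidef _ from h₁))
    ext i j a b
    exact congrFun (congrFun h₄ (i, a)) (j, b)
  conj_mem α X h := by
    change Matrix.PosSemidef _
    rw [comp_matConj]
    exact h.mul_mul_conjTranspose_same _
  star_unit := star_one _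
  orderUnit {n X} hX := by
    have hH : (Matrix.comp (Fin n) (Fin n) (Fin k) (Fin k) ℂ X).IsHermitian := by
      ext ⟨i, a⟩ ⟨j, b⟩
      exact congrFun (congrFun (congrFun (congrFun hX i) j) a) b
    obtain ⟨r, hr, h⟩ := exists_smul_one_sub_posSemidef hH
    refine ⟨r, hr, ?_⟩
    rw [← comp_diagonal_smul_one] at h
    exact h
  archimedean {n X} h := by
    refine posSemidef_of_forall_smul_one_add fun r hr => ?_
    rw [← comp_diagonal_smul_one]
    exact h r hr

end Matrices

section Tensor

/-- The map `φ ⊗ ψ : S ⊗ T → M_k ⊗ M_m = M_{km}`, where `a ⊗ b` in `M_k ⊗ M_m` is identified with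
the Kronecker product of `a` and `b`. -/
noncomputable def mapTensor {S : Type u} [AddCommGroup S] [Module ℂ S]
    {T : Type v} [AddCommGroup T] [Module ℂ T] {k m : ℕ}
    (φ : S →ₗ[ℂ] Matrix (Fin k) (Fin k) ℂ) (ψ : T →ₗ[ℂ] Matrix (Fin m) (Fin m) ℂ) :
    S ⊗[ℂ] T →ₗ[ℂ] Matrix (Fin k × Fin m) (Fin k × Fin m) ℂ :=
  TensorProduct.lift ((Matrix.kroneckerBilinear (R := ℂ) (α := ℂ) (l := Fin k) (m := Fin k)
    (n := Fin m) (p := Fin m)).compl₁₂ φ ψ)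

variable (S : Type u) [AddCommGroup S] [Module ℂ S] [StarAddMonoid S] [StarModule ℂ S]
  [OperatorSystem S]
variable (T : Type v) [AddCommGroup T] [Module ℂ T] [StarAddMonoid T] [StarModule ℂ T]
  [OperatorSystem T]

/-- The cone `Mₙ(S ⊗_min T)⁺` of the minimal operator system tensor product. -/
def minCone (n : ℕ) : Set (Matrix (Fin n) (Fin n) (S ⊗[ℂ] T)) :=
  {X | ∀ (k m : ℕ) (φ : S →ₗ[ℂ] Matrix (Fin k) (Fin k) ℂ) (ψ : T →ₗ[ℂ] Matrix (Fin m) (Fin m) ℂ),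
    IsUCP φ → IsUCP ψ →
      (Matrix.comp (Fin n) (Fin n) (Fin k × Fin m) (Fin k × Fin m) ℂ
        (X.map (mapTensor φ ψ))).PosSemidef}

/-- The set `Dₙ^max(S, T)` of all `α (P ⊗ Q) α*` with `P` in `M_k(S)⁺`, `Q` in `M_l(T)⁺` and `α`
a scalar `n × kl` matrix. -/
def maxGen (n : ℕ) : Set (Matrix (Fin n) (Fin n) (S ⊗[ℂ] T)) :=
  {X | ∃ (k l : ℕ) (P : Matrix (Fin k) (Fin k) S) (Q : Matrix (Fin l) (Fin l) T)
    (α : Matrix (Fin n) (Fin k × Fin l) ℂ), P ∈ cone k ∧ Q ∈ cone l ∧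
      X = matConj α (Matrix.kroneckerMap (fun p q => p ⊗ₜ[ℂ] q) P Q)}

/-- The cone `Mₙ(S ⊗_max T)⁺` of the maximal operator system tensor product: the
Archimedeanization of `Dₙ^max(S, T)`. -/
def maxCone (n : ℕ) : Set (Matrix (Fin n) (Fin n) (S ⊗[ℂ] T)) :=
  {X | ∀ ε : ℝ, 0 < ε →
    X + Matrix.diagonal (fun _ : Fin n => (ε : ℂ) • ((unit : S) ⊗ₜ[ℂ] (unit : T))) ∈ maxGen S T n}

/-- `S ⊗_min T = S ⊗_max T`: the two operator system structures on the `*`-vector space `S ⊗ T`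
with unit `1 ⊗ 1` have the same positive cones at every matrix level. -/
def MinEqMax : Prop := ∀ n : ℕ, minCone S T n = maxCone S T n

/-- Nuclear operator systems: `S ⊗_min T = S ⊗_max T` for every operator system `T`. -/
def IsNuclear : Prop :=
  ∀ (T : Type v) [AddCommGroup T] [Module ℂ T] [StarAddMonoid T] [StarModule ℂ T]
    [OperatorSystem T], MinEqMax S T

/-- There are nets of unital completely positive maps `φ_λ : S → M_{n_λ}` and `ψ_λ : M_{n_λ} → S`
such that `ψ_λ ∘ φ_λ` converges to the identity of `S` in the point-norm topology. -/
def FactorsThroughMatrices : Prop :=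
  ∃ (Λ : Type u) (_ : Preorder Λ) (_ : IsDirectedOrder Λ) (_ : Nonempty Λ) (n : Λ → ℕ)
    (φ : (i : Λ) → S →ₗ[ℂ] Matrix (Fin (n i)) (Fin (n i)) ℂ)
    (ψ : (i : Λ) → Matrix (Fin (n i)) (Fin (n i)) ℂ →ₗ[ℂ] S),
    (∀ i, IsUCP (φ i)) ∧ (∀ i, IsUCP (ψ i)) ∧
      ∀ x : S, Filter.Tendsto (fun i => osNorm (ψ i (φ i x) - x)) Filter.atTop (𝓝 0)

end Tensor

end OperatorSystem

/-! From matrix factorizations to nuclearity: let `X` be positive in S ⊗_min T. Applying `φ ⊗ id`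
with `φ` ucp gives a positive matrix over T, because positivity over T is tested by ucp maps into
matrix algebras (`mem_cone_of_forall_isUCP`, by Hahn-Banach). Contracting it with the positive
matrix `[ψ(E_ab)]` shows that `(ψφ ⊗ id)(X)` has the form `α(P ⊗ Q)α*` (`map_rTensor_mem_maxGen`).
The error is absorbed by order, not by a tensor norm: write `X = ∑ e_m ⊗ X_m` with Hermitian `e_m`
biorthogonal to states `f_m`, so that the slices `X_m` are positive. If `δ1 + e_m - ψφ(e_m)` is
positive for every `m`, adding `∑ (δ1 + e_m - ψφ(e_m)) ⊗ X_m` turns `(ψφ ⊗ id)(X)` into `X + δ 1 ⊗ ∑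
X_m`, and for small `δ` the extra term is at most `ε 1 ⊗ 1`. This is
`FactorsThroughMatrices.minEqMax`.

Conversely, let E be the span of such a frame. Its dual is made an operator system with unit `∑
f_m`; a matrix over E* is positive if it is a limit of restrictions to E of completely positive maps
from S to `M_n`. Requiring the extension to S in the definition makes Arveson's theorem unnecessary.
The inclusion of E in S, seen in E* ⊗ S, is min-positive (`inclusionTensor_mem_minCone`). If it is
also max-positive, then up to `ε` it is `α(P ⊗ Q)α*`, and reading `P` as a map from E to `M_k` and
compressing `Q` to the Choi matrix of a map from `M_k` to S gives a completely positive
factorization of a perturbed inclusion (`Frame.exists_choi_factorization`). A small correction makes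
both maps unital (`exists_isUCP_factorization`). Only these finite-dimensional duals are tested, so
either nuclearity or its finite-dimensional form is enough. -/

section MatConj

/-! ### Congruence by scalar matrices -/

variable {V W : Type*} [AddCommGroup V] [Module ℂ V] [AddCommGroup W] [Module ℂ W]
variable {ι κ μ : Type*} [Fintype κ] [Fintype μ]

theorem matConj_apply (α : Matrix ι κ ℂ) (X : Matrix κ κ V) (i j : ι) :
    matConj α X i j = ∑ k, ∑ l, (α i k * star (α j l)) • X k l := rfl

theorem matConj_matConj (α : Matrix ι κ ℂ) (β : Matrix κ μ ℂ) (X : Matrix μ μ V) :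
    matConj α (matConj β X) = matConj (α * β) X := by
  ext i j
  simp only [matConj_apply, Matrix.mul_apply, Finset.smul_sum, smul_smul, star_sum,
    Finset.sum_mul_sum, Finset.sum_smul]
  have h1 : ∀ a : κ, (∑ b : κ, ∑ c : μ, ∑ d : μ,
      (α i a * star (α j b) * (β a c * star (β b d))) • X c d) =
      ∑ c : μ, ∑ d : μ, ∑ b : κ, (α i a * star (α j b) * (β a c * star (β b d))) • X c d := by
    intro a
    rw [Finset.sum_comm]
    exact Finset.sum_congr rfl fun c _ => Finset.sum_comm
  simp only [h1]
  rw [Finset.sum_comm]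
  refine Finset.sum_congr rfl fun c _ => ?_
  rw [Finset.sum_comm]
  refine Finset.sum_congr rfl fun d _ => Finset.sum_congr rfl fun a _ =>
    Finset.sum_congr rfl fun b _ => ?_
  congr 1
  rw [star_mul']
  ring

theorem matConj_one [DecidableEq κ] (X : Matrix κ κ V) : matConj (1 : Matrix κ κ ℂ) X = X := by
  ext i j
  simp [matConj_apply, Matrix.one_apply]

theorem matConj_add (α : Matrix ι κ ℂ) (X Y : Matrix κ κ V) :
    matConj α (X + Y) = matConj α X + matConj α Y := by
  ext i j
  simp [matConj_apply, Finset.sum_add_distrib]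

theorem matConj_map (f : V →ₗ[ℂ] W) (α : Matrix ι κ ℂ) (X : Matrix κ κ V) :
    (matConj α X).map f = matConj α (X.map f) := by
  ext i j
  simp [matConj_apply]

theorem matConj_diagonal [DecidableEq κ] (α : Matrix ι κ ℂ) (x : V) (i j : ι) :
    matConj α (Matrix.diagonal fun _ => x) i j = (α * α.conjTranspose) i j • x := by
  simp [matConj_apply, Matrix.diagonal_apply, Matrix.mul_apply, Finset.sum_smul]

theorem matConj_submatrix (α : Matrix ι κ ℂ) (e : μ ≃ κ) (X : Matrix κ κ V) :
    matConj (α.submatrix id e) (X.submatrix e e) = matConj α X := by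
  ext i j
  simp only [matConj_apply, Matrix.submatrix_apply, id]
  rw [← e.sum_comp]
  exact Finset.sum_congr rfl fun k _ => e.sum_comp fun l => (α i (e k) * star (α j l)) • X (e k) l

theorem matConj_fromBlocks (α : Matrix ι (κ ⊕ μ) ℂ) (X : Matrix κ κ V) (Y : Matrix μ μ V) :
    matConj α (Matrix.fromBlocks X 0 0 Y) =
      matConj (α.submatrix id Sum.inl) X + matConj (α.submatrix id Sum.inr) Y := by
  ext i j
  simp [matConj_apply]

theorem matConj_eq_mul (α : Matrix ι κ ℂ) (X : Matrix κ κ ℂ) :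
    matConj α X = α * X * α.conjTranspose := by
  ext i j
  simp only [matConj_apply, Matrix.mul_apply, Matrix.conjTranspose_apply, Finset.sum_mul,
    smul_eq_mul]
  rw [Finset.sum_comm]
  refine Finset.sum_congr rfl fun _ _ => Finset.sum_congr rfl fun _ _ => ?_
  ring

end MatConj

namespace OperatorSystem

/-! ### Positive matrices and order bounds for the norm -/

section Cones

variable {S : Type*} [AddCommGroup S] [Module ℂ S] [StarAddMonoid S] [StarModule ℂ S]
  [OperatorSystem S]

/-- Positivity of a matrix over an operator system that is indexed by an arbitrary finite type. -/
def PosMat {ι : Type*} [Fintype ι] (X : Matrix ι ι S) : Prop :=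
  ∀ (n : ℕ) (α : Matrix (Fin n) ι ℂ), matConj α X ∈ cone n

theorem posMat_fin {n : ℕ} {X : Matrix (Fin n) (Fin n) S} : PosMat X ↔ X ∈ cone n :=
  ⟨fun h => by simpa [matConj_one] using h n 1, fun h _ α => conj_mem α h⟩

theorem PosMat.matConj {ι κ : Type*} [Fintype ι] [Fintype κ] {X : Matrix κ κ S} (h : PosMat X)
    (α : Matrix ι κ ℂ) : PosMat (matConj α X) := fun n β => by
  rw [matConj_matConj]
  exact h n _

theorem PosMat.submatrix {ι κ : Type*} [Fintype ι] [Fintype κ] [DecidableEq κ] {X : Matrix κ κ S}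
    (h : PosMat X) (f : ι → κ) : PosMat (X.submatrix f f) := by
  convert h.matConj ((1 : Matrix κ κ ℂ).submatrix f id) using 1
  ext i j
  simp [matConj_apply, Matrix.one_apply]

theorem posMat_submatrix_equiv {ι κ : Type*} [Fintype ι] [Fintype κ] [DecidableEq κ]
    [DecidableEq ι] {X : Matrix κ κ S} (e : ι ≃ κ) : PosMat (X.submatrix e e) ↔ PosMat X :=
  ⟨fun h => by simpa using h.submatrix e.symm, fun h => h.submatrix e⟩

theorem PosMat.fromBlocks {ι κ : Type*} [Fintype ι] [Fintype κ] {X : Matrix ι ι S}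
    {Y : Matrix κ κ S} (hX : PosMat X) (hY : PosMat Y) :
    PosMat (Matrix.fromBlocks X 0 0 Y) := fun n α => by
  rw [matConj_fromBlocks]
  exact add_mem (hX n _) (hY n _)

theorem sum_mem {n : ℕ} {ι : Type*} (s : Finset ι) {X : ι → Matrix (Fin n) (Fin n) S}
    (h : ∀ i ∈ s, X i ∈ cone n) : ∑ i ∈ s, X i ∈ cone n :=
  Finset.sum_induction X (· ∈ cone n) (fun _ _ => add_mem) (zero_mem n) h

/-- Positive elements of an operator system. -/
def IsPos (x : S) : Prop := (Matrix.of fun _ _ : Fin 1 => x) ∈ cone 1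

theorem IsPos.add {x y : S} (hx : IsPos x) (hy : IsPos y) : IsPos (x + y) := add_mem hx hy

theorem IsPos.smul {x : S} (hx : IsPos x) {r : ℝ} (hr : 0 ≤ r) : IsPos ((r : ℂ) • x) :=
  smul_mem hr hx

theorem IsPos.star_eq {x : S} (hx : IsPos x) : star x = x :=
  congrFun (congrFun (cone_isHermitian hx) 0) 0

theorem eq_zero_of_isPos_neg {x : S} (hx : IsPos x) (hx' : IsPos (-x)) : x = 0 :=
  congrFun (congrFun (proper (X := Matrix.of fun _ _ : Fin 1 => x) hx hx') 0) 0

theorem isPos_matConj {n : ℕ} {X : Matrix (Fin n) (Fin n) S} (h : X ∈ cone n) (a : Fin n → ℂ) :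
    IsPos (∑ k, ∑ l, (a k * star (a l)) • X k l) :=
  conj_mem (Matrix.of fun _ : Fin 1 => a) h

theorem of_eq_diagonal {S : Type*} [Zero S] (x : S) :
    (Matrix.of fun _ _ : Fin 1 => x) = Matrix.diagonal fun _ => x := by
  ext i j
  simp [Subsingleton.elim i j]

/-- A positive element of `S` on the diagonal gives a positive matrix; more generally so does its
product with a positive semidefinite matrix. -/
theorem posSemidef_smul_mem {n : ℕ} {H : Matrix (Fin n) (Fin n) ℂ} (hH : H.PosSemidef) {x : S}
    (hx : IsPos x) : (Matrix.of fun i j => H i j • x) ∈ cone n := by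
  open scoped MatrixOrder in
  obtain ⟨B, hB⟩ := CStarAlgebra.nonneg_iff_eq_star_mul_self.mp hH.nonneg
  have : (Matrix.of fun i j => H i j • x) = ∑ t : Fin n,
      matConj (Matrix.of fun (i : Fin n) (_ : Fin 1) => star (B t i))
        (Matrix.of fun _ _ : Fin 1 => x) := by
    ext i j
    simp [Matrix.sum_apply, matConj_apply, hB, Matrix.mul_apply, Finset.sum_smul,
      Matrix.star_apply]
  rw [this]
  exact sum_mem _ fun t _ => conj_mem _ hx

theorem exists_isPos_sub {x : S} (hx : star x = x) :
    ∃ r : ℝ, 0 < r ∧ IsPos ((r : ℂ) • (unit : S) - x) := by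
  obtain ⟨r, hr, h⟩ := orderUnit (X := Matrix.of fun _ _ : Fin 1 => x) (by ext i j; exact hx)
  rw [← of_eq_diagonal] at h
  exact ⟨r, hr, h⟩

theorem isPos_unit : IsPos (unit : S) := by
  obtain ⟨r, hr, h⟩ := exists_isPos_sub (S := S) (x := 0) (star_zero _)
  have := h.smul (r := r⁻¹) (by positivity)
  rwa [sub_zero, smul_smul, ← Complex.ofReal_mul, inv_mul_cancel₀ hr.ne', Complex.ofReal_one,
    one_smul] at this

theorem diagonal_mem {n : ℕ} {x : S} (hx : IsPos x) :
    (Matrix.diagonal fun _ : Fin n => x) ∈ cone n := by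
  convert posSemidef_smul_mem (Matrix.PosSemidef.one (n := Fin n) (R := ℂ)) hx using 1
  ext i j
  by_cases h : i = j <;> simp [h]

/-- With unit 0, the order unit property makes every Hermitian element both positive and negative.
The zero system has no states, so it is treated apart later. -/
theorem eq_zero_of_unit_eq_zero (h : (unit : S) = 0) (x : S) : x = 0 := by
  have key : ∀ y : S, star y = y → y = 0 := by
    intro y hy
    obtain ⟨r, -, h1⟩ := exists_isPos_sub hy
    obtain ⟨r', -, h2⟩ := exists_isPos_sub (x := -y) (by rw [star_neg, hy])
    rw [h, smul_zero, zero_sub] at h1 h2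
    rw [neg_neg] at h2
    exact eq_zero_of_isPos_neg h2 h1
  have h1 := key (x + star x) (by rw [star_add, star_star, add_comm])
  have h2 := key (Complex.I • (x - star x)) (by
    rw [star_smul, star_sub, star_star, Complex.star_def, Complex.conj_I, neg_smul, ← smul_neg,
      neg_sub])
  have h3 : x - star x = 0 := by simpa using h2
  have h4 : (2 : ℂ) • x = 0 := by
    rw [two_smul]
    calc x + x = (x + star x) + (x - star x) := by abel
      _ = 0 := by rw [h1, h3, add_zero]
  simpa using h4

/-- The real number `t` bounds the norm of `x`. -/
def IsBound (t : ℝ) (x : S) : Prop :=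
  !![(t : ℂ) • (unit : S), x; star x, (t : ℂ) • (unit : S)] ∈ cone 2

theorem IsBound.add {s t : ℝ} {x y : S} (hx : IsBound s x) (hy : IsBound t y) :
    IsBound (s + t) (x + y) := by
  have := add_mem hx hy
  unfold IsBound
  convert this using 1
  ext i j
  fin_cases i <;> fin_cases j <;> simp [add_smul]

theorem isBound_zero : IsBound 0 (0 : S) := by
  unfold IsBound
  convert zero_mem (S := S) 2 using 1
  ext i j
  fin_cases i <;> fin_cases j <;> simp

theorem IsBound.smul {t : ℝ} {x : S} (hx : IsBound t x) (c : ℂ) : IsBound (‖c‖ * t) (c • x) := by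
  -- Conjugation by `diag(e^{iθ}, 1)` multiplies the off-diagonal entry by the phase of `c` and
  -- fixes the diagonal.
  have h := smul_mem (norm_nonneg c) (conj_mem !![Complex.exp (c.arg * Complex.I), 0; 0, 1] hx)
  unfold IsBound
  have hc := Complex.norm_mul_exp_arg_mul_I c
  have h1 : Complex.exp (c.arg * Complex.I) * star (Complex.exp (c.arg * Complex.I)) = 1 := by
    rw [Complex.star_def, Complex.mul_conj, Complex.normSq_eq_norm_sq, Complex.norm_exp_ofReal_mul_I]
    simp
  convert h using 1
  ext i j
  fin_cases i <;> fin_cases j <;>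
    simp only [matConj_apply, Fin.sum_univ_two, Matrix.smul_apply] <;>
    simp [-Complex.coe_smul, smul_smul]
  · rw [Complex.star_def] at h1
    rw [h1, one_mul]
  · congr 1
    conv_lhs => rw [← hc, map_mul, Complex.conj_ofReal]

theorem IsBound.mono {s t : ℝ} {x : S} (hx : IsBound s x) (h : s ≤ t) : IsBound t x := by
  have h1 := add_mem hx (diagonal_mem (n := 2) (isPos_unit.smul (S := S) (sub_nonneg.mpr h)))
  unfold IsBound
  convert h1 using 1
  ext i j
  fin_cases i <;> fin_cases j <;> simp [← add_smul, -Complex.coe_smul]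

theorem isBound_of_isPos {t : ℝ} {x : S} (h1 : IsPos ((t : ℂ) • (unit : S) + x))
    (h2 : IsPos ((t : ℂ) • (unit : S) - x)) : IsBound t x := by
  have hx : star x = x := by
    have h3 := h1.star_eq
    rw [star_add, star_smul, star_unit, Complex.star_def, Complex.conj_ofReal] at h3
    exact add_left_cancel h3
  -- The block matrix is half of `(t1 + x) ⊗ vv* + (t1 - x) ⊗ ww*`, where `v = (1, 1)` and `w = (1,
  -- -1)`.
  have h := smul_mem (r := 1 / 2) (by norm_num)
    (add_mem (conj_mem (Matrix.of fun (_ : Fin 2) (_ : Fin 1) => (1 : ℂ)) h1)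
      (conj_mem (Matrix.of fun (i : Fin 2) (_ : Fin 1) => if i = 0 then (1 : ℂ) else -1) h2))
  unfold IsBound
  convert h using 1
  ext i j
  fin_cases i <;> fin_cases j <;> simp [matConj_apply, hx] <;> module

theorem exists_isBound (x : S) : ∃ t : ℝ, 0 < t ∧ IsBound t x := by
  obtain ⟨t, ht, h⟩ := orderUnit (X := !![0, -x; -star x, 0]) (by
    ext i j
    fin_cases i <;> fin_cases j <;> simp)
  refine ⟨t, ht, ?_⟩
  unfold IsBound
  convert h using 1
  ext i j
  fin_cases i <;> fin_cases j <;> simp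

theorem osNorm_nonneg (x : S) : 0 ≤ osNorm x := Real.sInf_nonneg fun _ h => h.1

theorem IsBound.osNorm_le {t : ℝ} (ht : 0 ≤ t) {x : S} (h : IsBound t x) : osNorm x ≤ t :=
  csInf_le ⟨0, fun _ h => h.1⟩ ⟨ht, h⟩

theorem isBound_of_osNorm_lt {t : ℝ} {x : S} (h : osNorm x < t) : IsBound t x := by
  obtain ⟨s, hs, hb⟩ := exists_isBound x
  obtain ⟨r, hr, hrt⟩ := exists_lt_of_csInf_lt (by exact ⟨s, hs.le, hb⟩) h
  exact IsBound.mono hr.2 hrt.le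

theorem IsBound.isPos_sub {t : ℝ} {x : S} (h : IsBound t x) (hx : star x = x) :
    IsPos ((t : ℂ) • (unit : S) - x) := by
  have h1 := (isPos_matConj h ![1, -1]).smul (r := 1 / 2) (by norm_num)
  convert h1 using 1
  simp [Fin.sum_univ_two, hx]
  module

end Cones

/-! ### Completely positive maps and states -/

section CompletelyPositive

variable {S : Type*} [AddCommGroup S] [Module ℂ S] [StarAddMonoid S] [StarModule ℂ S]
  [OperatorSystem S]
variable {T : Type*} [AddCommGroup T] [Module ℂ T] [StarAddMonoid T] [StarModule ℂ T]
  [OperatorSystem T]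
variable {R : Type*} [AddCommGroup R] [Module ℂ R] [StarAddMonoid R] [StarModule ℂ R]
  [OperatorSystem R]

/-- Completely positive maps. -/
def IsCP (φ : S →ₗ[ℂ] T) : Prop :=
  ∀ (n : ℕ) (X : Matrix (Fin n) (Fin n) S), X ∈ cone n → X.map φ ∈ cone n

theorem IsUCP.isCP {φ : S →ₗ[ℂ] T} (h : IsUCP φ) : IsCP φ := h.map_cone

theorem IsCP.comp {ψ : T →ₗ[ℂ] R} {φ : S →ₗ[ℂ] T} (hψ : IsCP ψ) (hφ : IsCP φ) :
    IsCP (ψ ∘ₗ φ) := fun n X hX => hψ n _ (hφ n X hX)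

theorem IsCP.add {φ ψ : S →ₗ[ℂ] T} (hφ : IsCP φ) (hψ : IsCP ψ) : IsCP (φ + ψ) :=
  fun n X hX => add_mem (hφ n X hX) (hψ n X hX)

theorem IsCP.smul {φ : S →ₗ[ℂ] T} (hφ : IsCP φ) {r : ℝ} (hr : 0 ≤ r) : IsCP ((r : ℂ) • φ) :=
  fun n X hX => smul_mem hr (hφ n X hX)

theorem isCP_zero : IsCP (0 : S →ₗ[ℂ] T) := fun n _ _ => zero_mem n

theorem isCP_sum {ι : Type*} (s : Finset ι) {φ : ι → S →ₗ[ℂ] T} (h : ∀ i ∈ s, IsCP (φ i)) :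
    IsCP (∑ i ∈ s, φ i) :=
  Finset.sum_induction φ IsCP (fun _ _ => IsCP.add) isCP_zero h

theorem IsCP.isPos {φ : S →ₗ[ℂ] T} (hφ : IsCP φ) {x : S} (hx : IsPos x) : IsPos (φ x) :=
  hφ 1 _ hx

/-- Every `x` is a corner of a positive 2 × 2 matrix, whose image must be Hermitian. -/
theorem IsCP.map_star {φ : S →ₗ[ℂ] T} (hφ : IsCP φ) (x : S) : φ (star x) = star (φ x) := by
  obtain ⟨t, -, h⟩ := exists_isBound x
  have := congrFun (congrFun (cone_isHermitian (hφ 2 _ h)) 1) 0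
  simpa using this.symm

theorem IsCP.posMat {φ : S →ₗ[ℂ] T} (hφ : IsCP φ) {ι : Type*} [Fintype ι] {X : Matrix ι ι S}
    (hX : PosMat X) : PosMat (X.map φ) := fun n α => by
  rw [← matConj_map]
  exact hφ n _ (hX n α)

theorem mem_cone_matrix {n k : ℕ} {X : Matrix (Fin n) (Fin n) (Matrix (Fin k) (Fin k) ℂ)} :
    X ∈ cone n ↔ (Matrix.comp (Fin n) (Fin n) (Fin k) (Fin k) ℂ X).PosSemidef := Iff.rfl

theorem isPos_matrix {k : ℕ} {A : Matrix (Fin k) (Fin k) ℂ} : IsPos A ↔ A.PosSemidef := by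
  unfold IsPos
  rw [mem_cone_matrix]
  constructor
  · intro h
    exact h.submatrix fun i => ((0 : Fin 1), i)
  · intro h
    exact h.submatrix (Prod.snd : Fin 1 × Fin k → Fin k)

/-- States of an operator system. -/
structure IsState (f : S →ₗ[ℂ] ℂ) : Prop where
  map_unit : f unit = 1
  map_cone : ∀ (n : ℕ) (X : Matrix (Fin n) (Fin n) S), X ∈ cone n → (X.map f).PosSemidef

theorem IsState.map_star {f : S →ₗ[ℂ] ℂ} (hf : IsState f) (x : S) : f (star x) = star (f x) := by
  obtain ⟨t, -, h⟩ := exists_isBound x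
  have := congrFun (congrFun (hf.map_cone 2 _ h).1 1) 0
  simpa using this.symm

/-- The image of the block matrix has determinant `t² - |f x|²`, which is nonnegative. -/
theorem IsState.norm_le {f : S →ₗ[ℂ] ℂ} (hf : IsState f) {t : ℝ} (ht : 0 ≤ t) {x : S}
    (h : IsBound t x) : ‖f x‖ ≤ t := by
  have h1 := (hf.map_cone 2 _ h).det_nonneg
  rw [Matrix.det_fin_two] at h1
  simp only [Matrix.map_apply, Matrix.of_apply, Matrix.cons_val', Matrix.cons_val_zero,
    Matrix.cons_val_one, map_smul, hf.map_unit, hf.map_star] at h1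
  have h2 : f x * star (f x) = ((‖f x‖ ^ 2 : ℝ) : ℂ) := by
    rw [Complex.star_def, Complex.mul_conj, Complex.normSq_eq_norm_sq]
  simp only [smul_eq_mul, mul_one] at h1
  rw [h2, ← Complex.ofReal_mul, ← Complex.ofReal_sub, Complex.zero_le_real] at h1
  nlinarith [norm_nonneg (f x)]

theorem IsUCP.isState {k : ℕ} {φ : S →ₗ[ℂ] Matrix (Fin k) (Fin k) ℂ} (h : IsUCP φ) (i : Fin k) :
    IsState (Matrix.entryLinearMap ℂ ℂ i i ∘ₗ φ) where
  map_unit := by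
    simp only [LinearMap.comp_apply, h.map_unit]
    exact Matrix.one_apply_eq i
  map_cone n X hX := (h.map_cone n X hX).submatrix fun a => (a, i)

/-- The product of a state with a positive semidefinite matrix. -/
theorem IsState.isCP_smulRight {f : S →ₗ[ℂ] ℂ} (hf : IsState f) {k : ℕ}
    {H : Matrix (Fin k) (Fin k) ℂ} (hH : H.PosSemidef) : IsCP (f.smulRight H) := fun n X hX =>
  (hf.map_cone n X hX).kronecker hH

theorem IsState.isCP_smulRight_isPos {f : S →ₗ[ℂ] ℂ} (hf : IsState f) {p : T} (hp : IsPos p) :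
    IsCP (f.smulRight p) := fun n X hX => posSemidef_smul_mem (hf.map_cone n X hX) hp

/-- The congruence `A ↦ B A B*` between matrix algebras. -/
def congr {k m : ℕ} (B : Matrix (Fin m) (Fin k) ℂ) :
    Matrix (Fin k) (Fin k) ℂ →ₗ[ℂ] Matrix (Fin m) (Fin m) ℂ where
  toFun A := B * A * B.conjTranspose
  map_add' A A' := by rw [Matrix.mul_add, Matrix.add_mul]
  map_smul' c A := by simp

theorem congr_apply {k m : ℕ} (B : Matrix (Fin m) (Fin k) ℂ) (A : Matrix (Fin k) (Fin k) ℂ) :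
    congr B A = B * A * B.conjTranspose := rfl

theorem isCP_congr {k m : ℕ} (B : Matrix (Fin m) (Fin k) ℂ) : IsCP (congr B) := fun n X hX => by
  rw [mem_cone_matrix] at hX ⊢
  convert hX.mul_mul_conjTranspose_same ((1 : Matrix (Fin n) (Fin n) ℂ) ⊗ₖ B) using 1
  ext ⟨i, a⟩ ⟨j, b⟩
  simp [congr_apply, Matrix.mul_apply, Fintype.sum_prod_type, Matrix.one_apply, Finset.sum_mul]
  conv_rhs => rw [Finset.sum_comm]
  refine Finset.sum_congr rfl fun c _ => ?_
  conv_rhs => rw [Finset.sum_comm]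
  simp [apply_ite (starRingEnd ℂ)]

end CompletelyPositive

/-! ### Hahn-Banach separation and ucp maps that determine the order -/

section Separation

variable {S : Type*} [AddCommGroup S] [Module ℂ S] [StarAddMonoid S] [StarModule ℂ S]
  [OperatorSystem S]

/-- Hahn-Banach separation of a Hermitian matrix from the cone `Mₙ(S)⁺`. -/
theorem exists_separating_functional {n : ℕ} {X : Matrix (Fin n) (Fin n) S}
    (hX : X.conjTranspose = X) (h : X ∉ cone n) :
    ∃ F : Matrix (Fin n) (Fin n) S →ₗ[ℂ] ℂ, (∀ Y, F Y.conjTranspose = star (F Y)) ∧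
      (∀ Y ∈ cone n, 0 ≤ F Y) ∧ F (Matrix.diagonal fun _ => unit) = 1 ∧ (F X).re < 0 := by
  set D : Matrix (Fin n) (Fin n) S := Matrix.diagonal fun _ => unit with hD
  have hDs : ∀ r : ℂ, (Matrix.diagonal fun _ : Fin n => r • (unit : S)) = r • D := fun r => by
    ext i j
    by_cases hij : i = j <;> simp [hD, hij]
  have hDmem : D ∈ cone n := diagonal_mem isPos_unit
  obtain ⟨ε, hε, hXε⟩ : ∃ ε : ℝ, 0 < ε ∧ (ε : ℂ) • D + X ∉ cone n := by
    by_contra! hc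
    exact h (archimedean fun r hr => by rw [hDs]; exact hc r hr)
  set Z := (ε : ℂ) • D + X with hZ
  have hDh : D.conjTranspose = D := cone_isHermitian hDmem
  have hZh : Z.conjTranspose = Z := by
    rw [hZ, Matrix.conjTranspose_add, Matrix.conjTranspose_smul, hDh, hX, Complex.star_def,
      Complex.conj_ofReal]
  -- If a negative multiple of the unit were positive, the order unit property would make every
  -- Hermitian element positive, `Z` included.
  have hnegD : ∀ c : ℝ, c < 0 → (c : ℂ) • D ∉ cone n := by
    intro c hc hmem
    obtain ⟨r, hr, hrm⟩ := orderUnit (X := -Z) (by rw [Matrix.conjTranspose_neg, hZh])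
    rw [hDs, sub_neg_eq_add] at hrm
    have h1 := add_mem hrm (smul_mem (r := r / (-c)) (div_nonneg hr.le (by linarith)) hmem)
    rw [smul_smul, ← Complex.ofReal_mul, div_mul_eq_mul_div, div_neg, mul_div_cancel_right₀ _ hc.ne]
      at h1
    refine hXε ?_
    convert h1 using 1
    push_cast
    module
  have hD0 : D ≠ 0 := by
    intro h0
    refine hnegD (-1) (by norm_num) ?_
    rw [h0, smul_zero]
    exact zero_mem n
  have hrs : ∀ (r : ℝ) (Y : Matrix (Fin n) (Fin n) S), r • Y = (r : ℂ) • Y := fun r Y => by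
    rw [Complex.coe_smul]
  -- This real cone contains the positive matrices, `-Z` and every anti-Hermitian matrix. A real
  -- functional that is nonnegative on it is therefore positive, is nonpositive at `Z`, and is
  -- invariant under the adjoint. The Riesz extension theorem supplies one with value 1 at `D`.
  let C : PointedCone ℝ (Matrix (Fin n) (Fin n) S) :=
    { carrier := {Y | ∃ t : ℝ, 0 ≤ t ∧ Y + Y.conjTranspose + (t : ℂ) • Z ∈ cone n}
      add_mem' := by
        rintro Y Y' ⟨t, ht, h1⟩ ⟨t', ht', h2⟩
        refine ⟨t + t', add_nonneg ht ht', ?_⟩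
        convert add_mem h1 h2 using 1
        rw [Matrix.conjTranspose_add]
        push_cast
        module
      zero_mem' := ⟨0, le_rfl, by simpa using zero_mem n⟩
      smul_mem' := by
        rintro ⟨c, hc⟩ Y ⟨t, ht, h1⟩
        refine ⟨c * t, mul_nonneg hc ht, ?_⟩
        convert smul_mem hc h1 using 1
        rw [show ((⟨c, hc⟩ : {c : ℝ // 0 ≤ c}) • Y) = (c : ℂ) • Y from hrs c Y,
          Matrix.conjTranspose_smul, Complex.star_def, Complex.conj_ofReal]
        push_cast
        module }
  have hC : ∀ Y, Y ∈ C ↔ ∃ t : ℝ, 0 ≤ t ∧ Y + Y.conjTranspose + (t : ℂ) • Z ∈ cone n :=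
    fun Y => Iff.rfl
  obtain ⟨g, hg1, hg2⟩ := riesz_extension C (LinearPMap.mkSpanSingleton D (1 : ℝ) hD0) (by
      rintro ⟨x, hx⟩ hxC
      obtain ⟨c, rfl⟩ := Submodule.mem_span_singleton.mp hx
      rw [LinearPMap.mkSpanSingleton'_apply]
      obtain ⟨t, ht, h1⟩ := (hC _).mp hxC
      by_contra! hc
      have hc : c < 0 := by simpa using hc
      change c • D + (c • D).conjTranspose + _ ∈ _ at h1
      rw [hrs, Matrix.conjTranspose_smul, hDh, Complex.star_def, Complex.conj_ofReal] at h1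
      rcases ht.eq_or_lt with rfl | ht
      · refine hnegD (2 * c) (by linarith) ?_
        convert h1 using 1
        push_cast
        module
      · refine hXε ?_
        have h2 := smul_mem (r := t⁻¹) (by positivity)
          (add_mem h1 (smul_mem (r := -2 * c) (by linarith) hDmem))
        convert h2 using 1
        have ht' : (t : ℂ) ≠ 0 := by exact_mod_cast ht.ne'
        have : (c : ℂ) • D + (c : ℂ) • D + (t : ℂ) • Z + ((-2 * c : ℝ) : ℂ) • D = (t : ℂ) • Z := by
          push_cast
          module
        rw [this, smul_smul]
        push_cast
        rw [inv_mul_cancel₀ ht', one_smul]) (by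
      intro y
      obtain ⟨r, hr, h1⟩ := orderUnit (X := -(y + y.conjTranspose)) (by
        rw [Matrix.conjTranspose_neg, Matrix.conjTranspose_add, Matrix.conjTranspose_conjTranspose,
          add_comm])
      refine ⟨⟨(r / 2) • D, Submodule.smul_mem _ _ (Submodule.mem_span_singleton_self D)⟩,
        (hC _).mpr ⟨0, le_rfl, ?_⟩⟩
      rw [hDs] at h1
      convert h1 using 1
      change (r / 2) • D + y + ((r / 2) • D + y).conjTranspose + _ = _
      rw [hrs, Matrix.conjTranspose_add, Matrix.conjTranspose_smul, hDh, Complex.star_def,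
        Complex.conj_ofReal]
      push_cast
      module)
  have hgstar : ∀ Y, g Y.conjTranspose = g Y := by
    have key : ∀ Y : Matrix (Fin n) (Fin n) S, g (Y - Y.conjTranspose) ≥ 0 := fun Y =>
      hg2 _ ((hC _).mpr ⟨0, le_rfl, by simpa using zero_mem n⟩)
    intro Y
    have h1 := key Y
    have h2 := key Y.conjTranspose
    rw [Matrix.conjTranspose_conjTranspose] at h2
    rw [map_sub] at h1 h2
    linarith
  have hgpos : ∀ Y ∈ cone n, 0 ≤ g Y := fun Y hY =>
    hg2 _ ((hC _).mpr ⟨0, le_rfl, by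
      rw [cone_isHermitian hY, Complex.ofReal_zero, zero_smul, add_zero]
      exact add_mem hY hY⟩)
  have hgD : g D = 1 :=
    (hg1 ⟨D, Submodule.mem_span_singleton_self D⟩).trans
      (LinearPMap.mkSpanSingleton_apply ℝ ℝ hD0 1)
  have hgZ : g (-Z) ≥ 0 := hg2 _ ((hC _).mpr ⟨2, by norm_num, by
    rw [Matrix.conjTranspose_neg, hZh]
    convert zero_mem (S := S) n using 1
    push_cast
    module⟩)
  have hgX : g X < 0 := by
    rw [map_neg, hZ, map_add, ← hrs, map_smul, hgD] at hgZ
    simp only [smul_eq_mul, mul_one] at hgZ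
    linarith
  have hre : ∀ Y, (Module.Dual.extendRCLike (𝕜 := ℂ) g Y).re = g Y :=
    fun Y => Module.Dual.re_extendRCLike_apply (𝕜 := ℂ) g Y
  have him : ∀ Y, (Module.Dual.extendRCLike (𝕜 := ℂ) g Y).im = -g (Complex.I • Y) :=
    fun Y => Module.Dual.im_extendRCLike_apply (𝕜 := ℂ) g Y
  have hI : ∀ Y : Matrix (Fin n) (Fin n) S,
      g (Complex.I • Y.conjTranspose) = -g (Complex.I • Y) := fun Y => by
    rw [← hgstar (Complex.I • Y), Matrix.conjTranspose_smul, Complex.star_def, Complex.conj_I,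
      neg_smul, map_neg, neg_neg]
  have hHerm : ∀ Y : Matrix (Fin n) (Fin n) S, Y.conjTranspose = Y → g (Complex.I • Y) = 0 :=
    fun Y hY => by
      have := hI Y
      rw [hY] at this
      linarith
  refine ⟨Module.Dual.extendRCLike (𝕜 := ℂ) g, fun Y => ?_, fun Y hY => ?_, ?_, ?_⟩
  · apply Complex.ext
    · rw [Complex.star_def, Complex.conj_re, hre, hre, hgstar]
    · rw [Complex.star_def, Complex.conj_im, him, him, hI]
  · rw [Complex.le_def]
    exact ⟨by rw [hre]; exact hgpos Y hY, by rw [him, hHerm Y (cone_isHermitian hY)]; simp⟩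
  · apply Complex.ext
    · rw [hre, hgD, Complex.one_re]
    · rw [him, hHerm D hDh, Complex.one_im, neg_zero]
  · rwa [hre]

/-- The map `S → Mₙ` associated with a functional on `Mₙ(S)`. -/
noncomputable def functionalMap {S : Type*} [AddCommGroup S] [Module ℂ S] {n : ℕ} (F : Matrix (Fin n) (Fin n) S →ₗ[ℂ] ℂ) :
    S →ₗ[ℂ] Matrix (Fin n) (Fin n) ℂ where
  toFun x := Matrix.of fun i j => F (Matrix.single i j x)
  map_add' x y := by
    ext i j
    simp [Matrix.single_add]
  map_smul' c x := by
    ext i j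
    simp [← Matrix.smul_single]

theorem functionalMap_apply {S : Type*} [AddCommGroup S] [Module ℂ S] {n : ℕ} (F : Matrix (Fin n) (Fin n) S →ₗ[ℂ] ℂ) (x : S) (i j : Fin n) :
    functionalMap F x i j = F (Matrix.single i j x) := rfl

theorem functional_eq_sum {S : Type*} [AddCommGroup S] [Module ℂ S] {n : ℕ} (F : Matrix (Fin n) (Fin n) S →ₗ[ℂ] ℂ)
    (X : Matrix (Fin n) (Fin n) S) : F X = ∑ i, ∑ j, functionalMap F (X i j) i j := by
  conv_lhs => rw [Matrix.matrix_eq_sum_single X]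
  simp [functionalMap_apply]

/-- This identity turns positivity of `F` on `Mₙ(S)⁺` into complete positivity of the associated
map: each quadratic form of an amplification is `F` at a congruence of `P`. -/
theorem functionalMap_quadratic {S : Type*} [AddCommGroup S] [Module ℂ S] {n m : ℕ} (F : Matrix (Fin n) (Fin n) S →ₗ[ℂ] ℂ)
    (P : Matrix (Fin m) (Fin m) S) (x : Fin m × Fin n → ℂ) :
    star x ⬝ᵥ ((Matrix.comp _ _ _ _ ℂ (P.map (functionalMap F))).mulVec x) =
      F (matConj (Matrix.of fun i a => star (x (a, i))) P) := by
  rw [functional_eq_sum]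
  simp only [dotProduct, Matrix.mulVec, Fintype.sum_prod_type, matConj_apply, map_sum, map_smul,
    Matrix.sum_apply, Matrix.comp_apply, Matrix.map_apply, Pi.star_apply, Matrix.of_apply,
    star_star, Finset.mul_sum, Matrix.smul_apply, smul_eq_mul]
  rw [Finset.sum_comm]
  refine Finset.sum_congr rfl fun i _ => ?_
  conv_rhs => rw [Finset.sum_comm]
  refine Finset.sum_congr rfl fun a _ => ?_
  conv_rhs => rw [Finset.sum_comm]
  refine Finset.sum_congr rfl fun b _ => Finset.sum_congr rfl fun j _ => ?_
  ring

theorem isCP_functionalMap {n : ℕ} {F : Matrix (Fin n) (Fin n) S →ₗ[ℂ] ℂ}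
    (hF : ∀ Y, F Y.conjTranspose = star (F Y)) (hF' : ∀ Y ∈ cone n, 0 ≤ F Y) :
    IsCP (functionalMap F) := fun m P hP => by
  rw [mem_cone_matrix]
  refine Matrix.PosSemidef.of_dotProduct_mulVec_nonneg ?_ fun x => ?_
  · ext ⟨a, i⟩ ⟨b, j⟩
    simp only [Matrix.conjTranspose_apply, Matrix.comp_apply, Matrix.map_apply,
      functionalMap_apply]
    rw [← hF, Matrix.conjTranspose_single]
    have := congrFun (congrFun (cone_isHermitian hP) a) b
    rw [Matrix.conjTranspose_apply] at this
    rw [this]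
  · rw [functionalMap_quadratic]
    exact hF' _ (conj_mem _ hP)

/-- Separate `-1` from the cone of S. At matrix size 1 the normalization of the functional is
exactly unitality. -/
theorem exists_isState (h : (unit : S) ≠ 0) : ∃ f : S →ₗ[ℂ] ℂ, IsState f := by
  have h1 : (-Matrix.of fun _ _ : Fin 1 => (unit : S)) ∉ cone 1 := fun hc =>
    h (eq_zero_of_isPos_neg isPos_unit hc)
  obtain ⟨F, hF, hF', hF1, -⟩ := exists_separating_functional (by
    rw [Matrix.conjTranspose_neg, cone_isHermitian (isPos_unit (S := S))]) h1
  have hΦ : IsUCP (functionalMap F) := by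
    refine ⟨?_, isCP_functionalMap hF hF'⟩
    ext i j
    rw [Subsingleton.elim i 0, Subsingleton.elim j 0, functionalMap_apply]
    change _ = (1 : Matrix (Fin 1) (Fin 1) ℂ) 0 0
    rw [Matrix.one_apply_eq, ← hF1]
    congr 1
    ext a b
    simp [Subsingleton.elim a 0, Subsingleton.elim b 0]
  exact ⟨_, hΦ.isState 0⟩

theorem congr_congr {k m l : ℕ} (B : Matrix (Fin m) (Fin k) ℂ) (C : Matrix (Fin l) (Fin m) ℂ)
    (A : Matrix (Fin k) (Fin k) ℂ) : congr C (congr B A) = congr (C * B) A := by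
  simp only [congr_apply, Matrix.conjTranspose_mul, Matrix.mul_assoc]

theorem congr_one {k : ℕ} (A : Matrix (Fin k) (Fin k) ℂ) :
    congr (1 : Matrix (Fin k) (Fin k) ℂ) A = A := by
  simp [congr_apply]

/-- A completely positive map whose value at the unit is positive definite is congruent to a
unital one. -/
theorem IsCP.exists_isUCP_congr {k : ℕ} {φ : S →ₗ[ℂ] Matrix (Fin k) (Fin k) ℂ} (hφ : IsCP φ)
    (h : (φ unit).PosDef) : ∃ B C : Matrix (Fin k) (Fin k) ℂ, C * B = 1 ∧
      IsUCP (congr B ∘ₗ φ) := by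
  obtain ⟨C, hC⟩ : ∃ C : Matrix (Fin k) (Fin k) ℂ, φ unit = C * C.conjTranspose := by
    open scoped MatrixOrder in
    obtain ⟨C, hC⟩ := CStarAlgebra.nonneg_iff_eq_star_mul_self.mp h.posSemidef.nonneg
    exact ⟨star C, by rw [hC, ← Matrix.star_eq_conjTranspose, star_star]⟩
  have hu : IsUnit C.det := by
    have h1 := h.det_pos.ne'
    rw [hC, Matrix.det_mul] at h1
    exact isUnit_iff_ne_zero.mpr (left_ne_zero_of_mul h1)
  have h1 : C⁻¹ * C = 1 := Matrix.nonsing_inv_mul C hu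
  refine ⟨C⁻¹, C, Matrix.mul_nonsing_inv C hu, ?_, (isCP_congr _).comp hφ⟩
  change C⁻¹ * φ unit * (C⁻¹).conjTranspose = 1
  rw [hC, ← Matrix.mul_assoc, h1, Matrix.one_mul, ← Matrix.conjTranspose_mul, h1,
    Matrix.conjTranspose_one]

/-- Evaluation at the vector `∑ e_i ⊗ e_i`; this is the pairing that recovers `F X` from the map
associated with `F`. -/
theorem sum_nonneg_of_mem_cone {n : ℕ} {Y : Matrix (Fin n) (Fin n) (Matrix (Fin n) (Fin n) ℂ)}
    (hY : Y ∈ cone n) : 0 ≤ ∑ i, ∑ j, Y i j i j := by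
  have := (mem_cone_matrix.mp hY).dotProduct_mulVec_nonneg fun p => if p.1 = p.2 then 1 else 0
  simpa [dotProduct, Matrix.mulVec, Fintype.sum_prod_type] using this

theorem posDef_add_smul_one {k : ℕ} {A : Matrix (Fin k) (Fin k) ℂ} (hA : A.PosSemidef) {r : ℝ}
    (hr : 0 < r) : (A + (r : ℂ) • (1 : Matrix (Fin k) (Fin k) ℂ)).PosDef :=
  Matrix.PosDef.posSemidef_add hA (Matrix.PosDef.one.smul (by exact_mod_cast hr))

/-- A separating functional `F` gives a completely positive map, possibly with singular value at the
unit. Adding `ε f(·) I` for a state `f` makes that value invertible, so the sum can be normalized,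
tested by the hypothesis and transformed back. Pairing yields `F X + ε ∑ f(X_ii) ≥ 0`, which fails
for small `ε`. -/
theorem mem_cone_of_forall_isUCP_of_isHermitian {n : ℕ} {X : Matrix (Fin n) (Fin n) S}
    (hX : X.conjTranspose = X)
    (h : ∀ φ : S →ₗ[ℂ] Matrix (Fin n) (Fin n) ℂ, IsUCP φ → X.map φ ∈ cone n) : X ∈ cone n := by
  by_contra hXn
  have hunit : (unit : S) ≠ 0 := by
    intro h0
    have : X = 0 := by
      ext i j
      exact eq_zero_of_unit_eq_zero h0 _
    exact hXn (this ▸ zero_mem n)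
  obtain ⟨f, hf⟩ := exists_isState hunit
  obtain ⟨F, hF, hF', -, hFX⟩ := exists_separating_functional hX hXn
  have hΦ := isCP_functionalMap hF hF'
  have key : ∀ ε : ℝ, 0 < ε → 0 ≤ (F X).re + ε * (∑ i, f (X i i)).re := by
    intro ε hε
    have hI : ((ε : ℂ) • (1 : Matrix (Fin n) (Fin n) ℂ)).PosSemidef :=
      Matrix.PosSemidef.one.smul (by exact_mod_cast hε.le)
    have hΨ := hΦ.add (hf.isCP_smulRight hI)
    obtain ⟨B, C, hCB, hu⟩ := hΨ.exists_isUCP_congr (by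
      have := posDef_add_smul_one (isPos_matrix.mp (hΦ.isPos isPos_unit)) hε
      simpa [hf.map_unit] using this)
    have h1 := isCP_congr C n _ (h _ hu)
    have h2 : ((X.map (congr B ∘ₗ (functionalMap F + f.smulRight ((ε : ℂ) •
        (1 : Matrix (Fin n) (Fin n) ℂ))))).map (congr C)) =
        X.map (functionalMap F + f.smulRight ((ε : ℂ) • (1 : Matrix (Fin n) (Fin n) ℂ))) := by
      ext1 i j
      simp only [Matrix.map_apply, LinearMap.comp_apply, congr_congr, hCB, congr_one]
    rw [h2] at h1
    have h3 := (Complex.le_def.mp (sum_nonneg_of_mem_cone h1)).1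
    rw [functional_eq_sum]
    simpa [Finset.sum_add_distrib, Matrix.one_apply, Finset.mul_sum, mul_comm] using h3
  set c := (∑ i, f (X i i)).re
  -- This `ε` makes the error term at most half of `-F X`.
  have h1 := key (-(F X).re / (2 * (|c| + 1))) (by
    have := abs_nonneg c
    apply div_pos <;> linarith)
  have hc : 0 < |c| + 1 := by positivity
  have h2 : -(F X).re / (2 * (|c| + 1)) * c ≤ -(F X).re / 2 := by
    rw [div_mul_eq_mul_div, div_le_div_iff₀ (by positivity) (by norm_num)]
    nlinarith [le_abs_self c]
  linarith

/-- States separate the points of an operator system. -/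
theorem eq_zero_of_forall_isState {x : S} (h : ∀ f : S →ₗ[ℂ] ℂ, IsState f → f x = 0) : x = 0 := by
  have key : ∀ y : S, star y = y → (∀ f : S →ₗ[ℂ] ℂ, IsState f → f y = 0) → IsPos y := by
    intro y hy hfy
    refine mem_cone_of_forall_isUCP_of_isHermitian (by ext i j; exact hy) fun φ hφ => ?_
    have h0 : φ y = 0 := by
      ext i j
      rw [Subsingleton.elim i 0, Subsingleton.elim j 0]
      exact hfy _ (hφ.isState 0)
    convert zero_mem (S := Matrix (Fin 1) (Fin 1) ℂ) 1 using 1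
    ext1 i j
    exact h0
  have key' : ∀ y : S, star y = y → (∀ f : S →ₗ[ℂ] ℂ, IsState f → f y = 0) → y = 0 :=
    fun y hy hfy => eq_zero_of_isPos_neg (key y hy hfy)
      (key (-y) (by rw [star_neg, hy]) fun f hf => by rw [map_neg, hfy f hf, neg_zero])
  have h1 := key' (x + star x) (by rw [star_add, star_star, add_comm]) fun f hf => by
    rw [map_add, hf.map_star, h f hf, star_zero, add_zero]
  have h2 := key' (Complex.I • (x - star x)) (by
    rw [star_smul, star_sub, star_star, Complex.star_def, Complex.conj_I, neg_smul, ← smul_neg,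
      neg_sub]) fun f hf => by
    rw [map_smul, map_sub, hf.map_star, h f hf, star_zero, sub_zero, smul_zero]
  have h3 : x - star x = 0 := by simpa using h2
  have h4 : (2 : ℂ) • x = 0 := by
    rw [two_smul]
    calc x + x = (x + star x) + (x - star x) := by abel
      _ = 0 := by rw [h1, h3, add_zero]
  simpa using h4

theorem IsState.isUCP_smulRight_one {f : S →ₗ[ℂ] ℂ} (hf : IsState f) (k : ℕ) :
    IsUCP (f.smulRight (1 : Matrix (Fin k) (Fin k) ℂ)) where
  map_unit := by
    rw [LinearMap.smulRight_apply, hf.map_unit, one_smul]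
    rfl
  map_cone := hf.isCP_smulRight Matrix.PosSemidef.one

/-- The cone `Mₙ(S)⁺` is determined by the unital completely positive maps into `Mₙ`. -/
theorem mem_cone_of_forall_isUCP {n : ℕ} {X : Matrix (Fin n) (Fin n) S}
    (h : ∀ φ : S →ₗ[ℂ] Matrix (Fin n) (Fin n) ℂ, IsUCP φ → X.map φ ∈ cone n) : X ∈ cone n := by
  refine mem_cone_of_forall_isUCP_of_isHermitian ?_ h
  ext i j
  rw [Matrix.conjTranspose_apply, ← sub_eq_zero]
  -- The ucp maps `f(·) I` show that every state sees `X` as Hermitian, and states separate points.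
  refine eq_zero_of_forall_isState fun f hf => ?_
  have h1 := congrFun (congrFun (cone_isHermitian (h _ (hf.isUCP_smulRight_one n))) i) j
  have h2 := congrFun (congrFun h1 i) i
  rw [map_sub, hf.map_star, sub_eq_zero]
  simpa using h2

theorem posMat_of_forall_isUCP {ι : Type*} [Fintype ι] [DecidableEq ι] {X : Matrix ι ι S}
    (h : ∀ (k : ℕ) (φ : S →ₗ[ℂ] Matrix (Fin k) (Fin k) ℂ), IsUCP φ → PosMat (X.map φ)) :
    PosMat X := by
  rw [← posMat_submatrix_equiv (Fintype.equivFin ι).symm, posMat_fin]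
  refine mem_cone_of_forall_isUCP fun φ hφ => ?_
  rw [← posMat_fin]
  exact (h _ φ hφ).submatrix _

end Separation

/-! ### Frames: Hermitian elements biorthogonal to states -/

section Frames

variable {S : Type*} [AddCommGroup S] [Module ℂ S] [StarAddMonoid S] [StarModule ℂ S]
  [OperatorSystem S]

variable (S) in
/-- A finite biorthogonal system of Hermitian elements `e m` and states `f m` of `S`, such that the
unit is in the span of the `e m`. -/
structure Frame (κ : Type*) [Fintype κ] [DecidableEq κ] where
  e : κ → S
  f : κ → S →ₗ[ℂ] ℂ
  star_e : ∀ m, star (e m) = e m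
  isState_f : ∀ m, IsState (f m)
  f_e : ∀ l m, f l (e m) = if l = m then 1 else 0
  sum_e : ∑ m, e m = unit

/-- States separate the points of `V`, so their restrictions have zero coannihilator and span the
finite-dimensional dual. A basis can be selected from any spanning set. -/
theorem exists_states_basis (V : Submodule ℂ S) [FiniteDimensional ℂ V] :
    ∃ (d : ℕ) (b : Module.Basis (Fin d) ℂ (Module.Dual ℂ V)),
      ∀ m, ∃ f : S →ₗ[ℂ] ℂ, IsState f ∧ b m = f ∘ₗ V.subtype := by
  set s : Set (Module.Dual ℂ V) := {g | ∃ f : S →ₗ[ℂ] ℂ, IsState f ∧ g = f ∘ₗ V.subtype}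
  have hs : ⊤ ≤ Submodule.span ℂ s := by
    have h1 : (Submodule.span ℂ s).dualCoannihilator = ⊥ := by
      rw [eq_bot_iff]
      intro x hx
      rw [Submodule.mem_dualCoannihilator] at hx
      rw [Submodule.mem_bot]
      exact Subtype.ext (eq_zero_of_forall_isState fun f hf =>
        hx _ (Submodule.subset_span ⟨f, hf, rfl⟩))
    rw [← Subspace.dualCoannihilator_dualAnnihilator_eq (W := Submodule.span ℂ s), h1,
      Submodule.dualAnnihilator_bot]
  let b := Module.Basis.ofSpan hs
  have := FiniteDimensional.fintypeBasisIndex b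
  refine ⟨_, b.reindex (Fintype.equivFin _), fun m => ?_⟩
  exact Module.Basis.ofSpan_subset hs ⟨(Fintype.equivFin _).symm m, by
    rw [Module.Basis.reindex_apply]⟩

theorem exists_frame (F : Finset S) :
    ∃ (d : ℕ) (B : Frame S (Fin d)), ∀ x ∈ F, ∑ m, B.f m x • B.e m = x := by
  classical
  set G : Set S := insert unit ((F : Set S) ∪ star '' (F : Set S)) with hG
  set V := Submodule.span ℂ G with hV
  have : FiniteDimensional ℂ V := FiniteDimensional.span_of_finite ℂ (by
    rw [hG]
    exact (F.finite_toSet.union (F.finite_toSet.image _)).insert _)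
  have hGstar : ∀ x ∈ G, star x ∈ G := by
    rintro x (rfl | hx | ⟨y, hy, rfl⟩)
    · rw [star_unit]
      exact Or.inl rfl
    · exact Or.inr (Or.inr ⟨x, hx, rfl⟩)
    · rw [star_star]
      exact Or.inr (Or.inl hy)
  have hVstar : ∀ x ∈ V, star x ∈ V := by
    intro x hx
    induction hx using Submodule.span_induction with
    | mem x hx => exact Submodule.subset_span (hGstar x hx)
    | zero => rw [star_zero]; exact V.zero_mem
    | add x y _ _ h1 h2 => rw [star_add]; exact V.add_mem h1 h2
    | smul c x _ h => rw [star_smul]; exact V.smul_mem _ h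
  obtain ⟨d, b, hb⟩ := exists_states_basis V
  choose f hf hbf using hb
  have hsep : ∀ v ∈ V, (∀ m, f m v = 0) → v = 0 := by
    intro v hv h
    have h1 : Module.Dual.eval ℂ V ⟨v, hv⟩ = 0 := b.ext fun m => by
      rw [Module.Dual.eval_apply, hbf, LinearMap.zero_apply]
      exact h m
    have h2 := (Module.forall_dual_apply_eq_zero_iff ℂ (⟨v, hv⟩ : V)).mp fun g => by
      rw [← Module.Dual.eval_apply, h1, LinearMap.zero_apply]
    exact congrArg Subtype.val h2
  -- The basis of `V` predual to the states. It is Hermitian because states respect the involution,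
  -- and it sums to the unit because each state is 1 there.
  let e : Fin d → V := fun m => (Module.evalEquiv ℂ V).symm (b.dualBasis m)
  have hfe : ∀ l m, f l (e m) = if l = m then 1 else 0 := by
    intro l m
    have h1 : b l (e m) = b.dualBasis m (b l) := by
      rw [← Module.apply_evalEquiv_symm_apply]
    rw [hbf] at h1
    refine h1.trans ?_
    rw [← hbf, Module.Basis.dualBasis_apply_self]
  have hexp : ∀ v ∈ V, ∑ m, f m v • (e m : S) = v := by
    intro v hv
    refine sub_eq_zero.mp (hsep _ (V.sub_mem (V.sum_mem fun m _ => V.smul_mem _ (e m).2) hv) ?_)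
    intro l
    simp [hfe]
  have hunit : (unit : S) ∈ V := Submodule.subset_span (Or.inl rfl)
  refine ⟨d, ⟨fun m => e m, f, fun m => ?_, hf, hfe, ?_⟩, fun x hx =>
    hexp x (Submodule.subset_span (Or.inr (Or.inl hx)))⟩
  · refine sub_eq_zero.mp (hsep _ (V.sub_mem (hVstar _ (e m).2) (e m).2) fun l => ?_)
    rw [map_sub, (hf l).map_star, hfe]
    split_ifs <;> simp
  · have := hexp unit hunit
    simpa [fun m => (hf m).map_unit] using this

end Frames

/-! ### The maximal cone, and symmetry of both tensor products -/

section Maximal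

variable {S : Type*} [AddCommGroup S] [Module ℂ S] [StarAddMonoid S] [StarModule ℂ S]
  [OperatorSystem S]
variable {T : Type*} [AddCommGroup T] [Module ℂ T] [StarAddMonoid T] [StarModule ℂ T]
  [OperatorSystem T]

/-- The matrix `P ⊗ Q` over `S ⊗ T`. -/
abbrev tmulMat {ι κ : Type*} (P : Matrix ι ι S) (Q : Matrix κ κ T) :
    Matrix (ι × κ) (ι × κ) (S ⊗[ℂ] T) :=
  Matrix.kroneckerMap (fun p q => p ⊗ₜ[ℂ] q) P Q

theorem matConj_tmulMat_mem_maxGen {ι κ : Type*} [Fintype ι] [Fintype κ] [DecidableEq ι]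
    [DecidableEq κ] {n : ℕ} {P : Matrix ι ι S} {Q : Matrix κ κ T} (hP : PosMat P) (hQ : PosMat Q)
    (α : Matrix (Fin n) (ι × κ) ℂ) : matConj α (tmulMat P Q) ∈ maxGen S T n := by
  let e := (Fintype.equivFin ι).symm
  let e' := (Fintype.equivFin κ).symm
  refine ⟨_, _, P.submatrix e e, Q.submatrix e' e', α.submatrix id (Prod.map e e'),
    posMat_fin.mp (hP.submatrix e), posMat_fin.mp (hQ.submatrix e'), ?_⟩
  exact (matConj_submatrix α (e.prodCongr e') (tmulMat P Q)).symm

/-- Take the direct sums of the two `P` and of the two `Q`, with a scalar matrix that vanishes on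
the mixed blocks. -/
theorem maxGen_add_mem {n : ℕ} {X Y : Matrix (Fin n) (Fin n) (S ⊗[ℂ] T)}
    (hX : X ∈ maxGen S T n) (hY : Y ∈ maxGen S T n) : X + Y ∈ maxGen S T n := by
  obtain ⟨k, l, P, Q, α, hP, hQ, rfl⟩ := hX
  obtain ⟨k', l', P', Q', α', hP', hQ', rfl⟩ := hY
  convert matConj_tmulMat_mem_maxGen ((posMat_fin.mpr hP).fromBlocks (posMat_fin.mpr hP'))
    ((posMat_fin.mpr hQ).fromBlocks (posMat_fin.mpr hQ'))
    (Matrix.of fun i (p : (Fin k ⊕ Fin k') × (Fin l ⊕ Fin l')) =>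
      Sum.elim (fun a => Sum.elim (fun b => α i (a, b)) (fun _ => 0) p.2)
        (fun a => Sum.elim (fun _ => 0) (fun b => α' i (a, b)) p.2) p.1) using 1
  ext i j
  simp [matConj_apply, Fintype.sum_prod_type, Fintype.sum_sum_type]

theorem zero_mem_maxGen (n : ℕ) : (0 : Matrix (Fin n) (Fin n) (S ⊗[ℂ] T)) ∈ maxGen S T n := by
  refine ⟨0, 0, 0, 0, 0, zero_mem 0, zero_mem 0, ?_⟩
  ext i j
  simp [matConj_apply]

theorem sum_mem_maxGen {n : ℕ} {ι : Type*} (s : Finset ι)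
    {X : ι → Matrix (Fin n) (Fin n) (S ⊗[ℂ] T)} (h : ∀ i ∈ s, X i ∈ maxGen S T n) :
    ∑ i ∈ s, X i ∈ maxGen S T n :=
  Finset.sum_induction X (· ∈ maxGen S T n) (fun _ _ => maxGen_add_mem) (zero_mem_maxGen n) h

theorem map_tmul_mem_maxGen {n : ℕ} {s : S} (hs : IsPos s) {Q : Matrix (Fin n) (Fin n) T}
    (hQ : Q ∈ cone n) : Q.map (fun q => s ⊗ₜ[ℂ] q) ∈ maxGen S T n := by
  refine ⟨1, n, Matrix.of fun _ _ => s, Q, (1 : Matrix (Fin n) (Fin n) ℂ).submatrix id Prod.snd,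
    hs, hQ, ?_⟩
  ext i j
  simp [matConj_apply, Fintype.sum_prod_type, Matrix.one_apply]

theorem mapTensor_tmul {S T : Type*} [AddCommGroup S] [Module ℂ S] [AddCommGroup T]
    [Module ℂ T] {k m : ℕ} (φ : S →ₗ[ℂ] Matrix (Fin k) (Fin k) ℂ)
    (ψ : T →ₗ[ℂ] Matrix (Fin m) (Fin m) ℂ) (s : S) (t : T) :
    mapTensor φ ψ (s ⊗ₜ t) = φ s ⊗ₖ ψ t := rfl

theorem comp_matConj_posSemidef {ι κ μ : Type*} [Fintype ι] [Fintype κ] [Fintype μ]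
    [DecidableEq μ] (α : Matrix ι κ ℂ) {X : Matrix κ κ (Matrix μ μ ℂ)}
    (h : (Matrix.comp _ _ _ _ ℂ X).PosSemidef) :
    (Matrix.comp _ _ _ _ ℂ (matConj α X)).PosSemidef := by
  convert h.mul_mul_conjTranspose_same (α ⊗ₖ (1 : Matrix μ μ ℂ)) using 1
  ext ⟨i, a⟩ ⟨j, b⟩
  simp only [Matrix.comp_apply, matConj_apply, Matrix.sum_apply, Matrix.smul_apply,
    Matrix.mul_apply, Fintype.sum_prod_type, Matrix.conjTranspose_apply,
    Matrix.kroneckerMap_apply, Matrix.one_apply, smul_eq_mul]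
  simp only [mul_ite, mul_one, mul_zero, ite_mul, zero_mul, Finset.sum_ite_eq, Finset.mem_univ,
    if_true, Finset.sum_mul, apply_ite star, star_zero]
  rw [Finset.sum_comm]
  refine Finset.sum_congr rfl fun _ _ => Finset.sum_congr rfl fun _ _ => ?_
  ring

theorem maxGen_subset_minCone (n : ℕ) : maxGen S T n ⊆ minCone S T n := by
  rintro X ⟨k, l, P, Q, α, hP, hQ, rfl⟩ a b φ ψ hφ hψ
  rw [matConj_map]
  refine comp_matConj_posSemidef α ?_
  have h := (mem_cone_matrix.mp (hφ.map_cone k P hP)).kronecker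
    (mem_cone_matrix.mp (hψ.map_cone l Q hQ))
  exact h.submatrix fun p : (Fin k × Fin l) × (Fin a × Fin b) =>
    ((p.1.1, p.2.1), (p.1.2, p.2.2))

theorem maxCone_subset_minCone (n : ℕ) : maxCone S T n ⊆ minCone S T n := by
  intro X hX a b φ ψ hφ hψ
  refine posSemidef_of_forall_smul_one_add fun r hr => ?_
  convert maxGen_subset_minCone n (hX r hr) a b φ ψ hφ hψ using 1
  ext ⟨i, p⟩ ⟨j, q⟩
  have h1 : mapTensor φ ψ ((unit : S) ⊗ₜ (unit : T)) = 1 := by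
    rw [mapTensor_tmul, hφ.map_unit, hψ.map_unit]
    exact Matrix.one_kronecker_one
  by_cases hij : i = j <;> simp [hij, h1, Matrix.one_apply, add_comm]

theorem maxGen_map_comm {n : ℕ} {X : Matrix (Fin n) (Fin n) (S ⊗[ℂ] T)} (hX : X ∈ maxGen S T n) :
    X.map (TensorProduct.comm ℂ S T) ∈ maxGen T S n := by
  obtain ⟨k, l, P, Q, α, hP, hQ, rfl⟩ := hX
  refine ⟨l, k, Q, P, α.submatrix id Prod.swap, hQ, hP, ?_⟩
  rw [← matConj_submatrix (α.submatrix id Prod.swap) (Equiv.prodComm (Fin k) (Fin l))]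
  exact matConj_map (TensorProduct.comm ℂ S T).toLinearMap _ _

theorem maxCone_map_comm {n : ℕ} {X : Matrix (Fin n) (Fin n) (S ⊗[ℂ] T)}
    (hX : X ∈ maxCone S T n) : X.map (TensorProduct.comm ℂ S T) ∈ maxCone T S n := by
  intro ε hε
  convert maxGen_map_comm (hX ε hε) using 1
  ext i j
  by_cases hij : i = j <;> simp [hij, -Complex.coe_smul]

theorem mapTensor_comm {S T : Type*} [AddCommGroup S] [Module ℂ S] [AddCommGroup T]
    [Module ℂ T] {k m : ℕ} (φ : S →ₗ[ℂ] Matrix (Fin k) (Fin k) ℂ)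
    (ψ : T →ₗ[ℂ] Matrix (Fin m) (Fin m) ℂ) (z : S ⊗[ℂ] T) :
    mapTensor ψ φ (TensorProduct.comm ℂ S T z) =
      (mapTensor φ ψ z).submatrix Prod.swap Prod.swap := by
  induction z with
  | zero => simp
  | tmul s t =>
    ext ⟨a, b⟩ ⟨c, d⟩
    simp [mapTensor_tmul, mul_comm]
  | add x y hx hy => simp only [map_add, hx, hy, Matrix.submatrix_add, Pi.add_apply]

theorem minCone_map_comm {n : ℕ} {X : Matrix (Fin n) (Fin n) (S ⊗[ℂ] T)}
    (hX : X ∈ minCone S T n) : X.map (TensorProduct.comm ℂ S T) ∈ minCone T S n := by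
  intro a b φ ψ hφ hψ
  convert (hX b a ψ φ hψ hφ).submatrix (fun p : Fin n × (Fin a × Fin b) => (p.1, p.2.swap)) using 1
  ext ⟨i, p⟩ ⟨j, q⟩
  simp [mapTensor_comm]

theorem MinEqMax.symm (h : MinEqMax S T) : MinEqMax T S := by
  intro n
  refine Set.Subset.antisymm (fun X hX => ?_) (maxCone_subset_minCone n)
  have h1 := minCone_map_comm hX
  rw [h n] at h1
  have h2 := maxCone_map_comm h1
  convert h2 using 1
  ext i j
  simp

end Maximal

/-! ### Slice maps -/

section Slices

variable {S T : Type*} [AddCommGroup S] [Module ℂ S] [AddCommGroup T] [Module ℂ T]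

/-- The slice map `f ⊗ id : S ⊗ T → T` of a functional `f` on `S`. -/
noncomputable def slice (T : Type*) [AddCommGroup T] [Module ℂ T] (f : S →ₗ[ℂ] ℂ) :
    S ⊗[ℂ] T →ₗ[ℂ] T :=
  (TensorProduct.lid ℂ T).toLinearMap ∘ₗ f.rTensor T

theorem slice_tmul (f : S →ₗ[ℂ] ℂ) (s : S) (t : T) : slice T f (s ⊗ₜ t) = f s • t := by
  simp [slice]

theorem mapTensor_apply {k m : ℕ} (φ : S →ₗ[ℂ] Matrix (Fin k) (Fin k) ℂ)
    (ψ : T →ₗ[ℂ] Matrix (Fin m) (Fin m) ℂ) (z : S ⊗[ℂ] T) (p q : Fin k × Fin m) :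
    mapTensor φ ψ z p q =
      ψ (slice T (Matrix.entryLinearMap ℂ ℂ p.1 q.1 ∘ₗ φ) z) p.2 q.2 := by
  induction z with
  | zero => simp
  | tmul s t => simp [mapTensor_tmul, slice_tmul]
  | add x y hx hy => simp only [map_add, Matrix.add_apply, hx, hy]

theorem rTensor_comp_eq_sum {k : ℕ} (φ : S →ₗ[ℂ] Matrix (Fin k) (Fin k) ℂ)
    (ψ : Matrix (Fin k) (Fin k) ℂ →ₗ[ℂ] S) (z : S ⊗[ℂ] T) :
    (ψ ∘ₗ φ).rTensor T z = ∑ a, ∑ b, ψ (Matrix.single a b 1) ⊗ₜ[ℂ]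
      slice T (Matrix.entryLinearMap ℂ ℂ a b ∘ₗ φ) z := by
  induction z with
  | zero => simp
  | tmul s t =>
    rw [LinearMap.rTensor_tmul, LinearMap.comp_apply, Matrix.matrix_eq_sum_single (φ s)]
    simp only [map_sum, TensorProduct.sum_tmul, slice_tmul, LinearMap.comp_apply,
      Matrix.entryLinearMap_apply]
    refine Finset.sum_congr rfl fun a _ => Finset.sum_congr rfl fun b _ => ?_
    rw [← TensorProduct.smul_tmul, ← map_smul, Matrix.smul_single]
    simp
  | add x y hx hy => simp only [map_add, hx, hy, TensorProduct.tmul_add, Finset.sum_add_distrib]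

end Slices

/-! ### From matrix factorizations to equality of the tensor products -/

section Nuclearity

variable {S : Type*} [AddCommGroup S] [Module ℂ S] [StarAddMonoid S] [StarModule ℂ S]
  [OperatorSystem S]
variable {T : Type*} [AddCommGroup T] [Module ℂ T] [StarAddMonoid T] [StarModule ℂ T]
  [OperatorSystem T]

theorem posMat_matrix_of_posSemidef {ι : Type*} [Fintype ι] {k : ℕ}
    {X : Matrix ι ι (Matrix (Fin k) (Fin k) ℂ)} (h : (Matrix.comp _ _ _ _ ℂ X).PosSemidef) :
    PosMat X := fun _ α => comp_matConj_posSemidef α h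

/-- The image of an element of `Mₙ(S ⊗_min T)⁺` in `Mₙ(M_k ⊗ T) = M_{nk}(T)` is positive. -/
theorem posMat_slice {n : ℕ} {X : Matrix (Fin n) (Fin n) (S ⊗[ℂ] T)} (hX : X ∈ minCone S T n)
    {k : ℕ} {φ : S →ₗ[ℂ] Matrix (Fin k) (Fin k) ℂ} (hφ : IsUCP φ) :
    PosMat (Matrix.of fun (p q : Fin n × Fin k) =>
      slice T (Matrix.entryLinearMap ℂ ℂ p.2 q.2 ∘ₗ φ) (X p.1 q.1)) := by
  -- Testing over T by ucp maps `ψ` reduces the claim to positivity of `(φ ⊗ ψ)(X)`, the definition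
  -- of the minimal cone.
  refine posMat_of_forall_isUCP fun m ψ hψ => posMat_matrix_of_posSemidef ?_
  convert (hX k m φ ψ hφ hψ).submatrix
    (fun p : (Fin n × Fin k) × Fin m => (p.1.1, (p.1.2, p.2))) using 1
  ext p q
  simp [mapTensor_apply]

theorem map_slice_mem_cone {n : ℕ} {X : Matrix (Fin n) (Fin n) (S ⊗[ℂ] T)}
    (hX : X ∈ minCone S T n) {f : S →ₗ[ℂ] ℂ} (hf : IsState f) : X.map (slice T f) ∈ cone n := by
  rw [← posMat_fin]
  convert (posMat_slice hX (hf.isUCP_smulRight_one 1)).submatrix (fun i : Fin n => (i, 0)) using 1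
  ext i j
  simp only [Matrix.map_apply, Matrix.submatrix_apply, Matrix.of_apply]
  congr 1
  congr 1
  ext x
  simp

/-- `(ψφ ⊗ id)(X)` is the contraction `∑ ψ(E_ab) ⊗ (φ_ab ⊗ id)(X)` of two positive matrices, one
over S and one over T. The scalar matrix implementing it pairs equal indices. -/
theorem map_rTensor_mem_maxGen {n : ℕ} {X : Matrix (Fin n) (Fin n) (S ⊗[ℂ] T)}
    (hX : X ∈ minCone S T n) {k : ℕ} {φ : S →ₗ[ℂ] Matrix (Fin k) (Fin k) ℂ} (hφ : IsUCP φ)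
    {ψ : Matrix (Fin k) (Fin k) ℂ →ₗ[ℂ] S} (hψ : IsUCP ψ) :
    X.map ((ψ ∘ₗ φ).rTensor T) ∈ maxGen S T n := by
  -- `[E_ab]` is the rank-one matrix `vv*` with `v = ∑ e_a ⊗ e_a`.
  have hE : PosMat (Matrix.of fun a b : Fin k => Matrix.single a b (1 : ℂ)) := by
    refine posMat_matrix_of_posSemidef ?_
    convert Matrix.posSemidef_vecMulVec_self_star
      (fun p : Fin k × Fin k => if p.1 = p.2 then (1 : ℂ) else 0) using 1
    ext ⟨a, b⟩ ⟨c, d⟩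
    simp [Matrix.vecMulVec_apply, Matrix.single_apply, ← ite_and, and_comm]
  convert matConj_tmulMat_mem_maxGen (hψ.isCP.posMat hE) (posMat_slice hX hφ)
    (Matrix.of fun i p => if p.2 = (i, p.1) then 1 else 0) using 1
  ext i j
  rw [Matrix.map_apply, rTensor_comp_eq_sum]
  simp [matConj_apply, Fintype.sum_prod_type_right, ite_and, Finset.sum_ite_irrel]

/-- An element of `S ⊗ T` is determined by its slices along a sufficiently large frame. -/
theorem exists_finset_frame_expansion {T : Type*} [AddCommGroup T] [Module ℂ T]
    (z : S ⊗[ℂ] T) :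
    ∃ F : Finset S, ∀ (d : ℕ) (B : Frame S (Fin d)), (∀ x ∈ F, ∑ m, B.f m x • B.e m = x) →
      z = ∑ m, B.e m ⊗ₜ slice T (B.f m) z := by
  classical
  induction z with
  | zero => exact ⟨∅, fun d B _ => by simp⟩
  | tmul s t =>
    refine ⟨{s}, fun d B h => ?_⟩
    conv_lhs => rw [← h s (Finset.mem_singleton_self s), TensorProduct.sum_tmul]
    simp only [slice_tmul, TensorProduct.smul_tmul]
  | add x y hx hy =>
    obtain ⟨F, hF⟩ := hx
    obtain ⟨G, hG⟩ := hy
    refine ⟨F ∪ G, fun d B h => ?_⟩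
    simp only [map_add, TensorProduct.tmul_add, Finset.sum_add_distrib]
    rw [← hF d B fun x hx => h x (Finset.mem_union_left _ hx),
      ← hG d B fun x hx => h x (Finset.mem_union_right _ hx)]

theorem exists_frame_expansion {T : Type*} [AddCommGroup T] [Module ℂ T]
    {n : ℕ} (X : Matrix (Fin n) (Fin n) (S ⊗[ℂ] T)) :
    ∃ (d : ℕ) (B : Frame S (Fin d)), ∀ i j, X i j = ∑ m, B.e m ⊗ₜ slice T (B.f m) (X i j) := by
  classical
  choose F hF using fun i j => exists_finset_frame_expansion (X i j)
  obtain ⟨d, B, hB⟩ := exists_frame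
    (Finset.univ.biUnion fun i => Finset.univ.biUnion fun j => F i j)
  refine ⟨d, B, fun i j => hF i j d B fun x hx => hB x ?_⟩
  simp only [Finset.mem_biUnion, Finset.mem_univ, true_and]
  exact ⟨i, j, hx⟩

theorem FactorsThroughMatrices.minEqMax (h : FactorsThroughMatrices S) : MinEqMax S T := by
  intro n
  refine Set.Subset.antisymm (fun X hX ε hε => ?_) (maxCone_subset_minCone n)
  obtain ⟨Λ, _, _, _, N, φ, ψ, hφ, hψ, hlim⟩ := h
  obtain ⟨d, B, hB⟩ := exists_frame_expansion X
  have hT : ∀ m, X.map (slice T (B.f m)) ∈ cone n := fun m =>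
    map_slice_mem_cone hX (B.isState_f m)
  have hsum := sum_mem Finset.univ fun m _ => hT m
  obtain ⟨r, hr, hr'⟩ := orderUnit (cone_isHermitian hsum)
  -- With `r` an upper bound for the sum of the slices, `δ = ε / r` makes `δ 1 ⊗ ∑ X_m` at most `ε 1
  -- ⊗ 1`.
  have hδ : 0 < ε / r := by positivity
  obtain ⟨i, hi⟩ := (Filter.eventually_all.mpr fun m =>
    (hlim (B.e m)).eventually_lt_const hδ).exists
  have hpos : ∀ m, IsPos (((ε / r : ℝ) : ℂ) • (unit : S) - (ψ i (φ i (B.e m)) - B.e m)) :=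
    fun m => (isBound_of_osNorm_lt (hi m)).isPos_sub (by
      rw [star_sub, ← (hψ i).isCP.map_star, ← (hφ i).isCP.map_star, B.star_e])
  have h1 := map_rTensor_mem_maxGen hX (hφ i) (hψ i)
  have h2 := sum_mem_maxGen Finset.univ fun m _ => map_tmul_mem_maxGen (hpos m) (hT m)
  have h3 := map_tmul_mem_maxGen (isPos_unit (S := S)) (smul_mem hδ.le hr')
  -- The three terms are `(ψφ ⊗ id)(X)`, `∑ (δ1 + e_m - ψφ(e_m)) ⊗ X_m` and `1 ⊗ δ(r1 - ∑ X_m)`.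
  -- Everything cancels except `X + ε 1 ⊗ 1`.
  convert maxGen_add_mem (maxGen_add_mem h1 h2) h3 using 1
  have hr0 : (r : ℂ) ≠ 0 := by exact_mod_cast hr.ne'
  have hdiag : ∀ a b, (Matrix.diagonal (fun _ : Fin n => (ε : ℂ) • ((unit : S) ⊗ₜ[ℂ] (unit : T))))
      a b = (unit : S) ⊗ₜ[ℂ] (((ε / r : ℝ) : ℂ) • Matrix.diagonal
        (fun _ : Fin n => (r : ℂ) • (unit : T)) a b) := by
    intro a b
    by_cases hab : a = b
    · subst hab
      rw [Matrix.diagonal_apply_eq, Matrix.diagonal_apply_eq, smul_smul, ← TensorProduct.tmul_smul]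
      push_cast
      rw [div_mul_cancel₀ _ hr0]
    · simp [hab]
  ext a b
  simp only [Matrix.add_apply, Matrix.map_apply, Matrix.sum_apply, Matrix.smul_apply,
    Matrix.sub_apply, hdiag, smul_sub, TensorProduct.tmul_sub, TensorProduct.sub_tmul,
    Finset.sum_sub_distrib]
  have h4 : (ψ i ∘ₗ φ i).rTensor T (X a b) =
      ∑ m, ψ i (φ i (B.e m)) ⊗ₜ[ℂ] slice T (B.f m) (X a b) := by
    conv_lhs => rw [hB a b]
    simp
  rw [h4, ← hB a b, Finset.smul_sum, TensorProduct.tmul_sum]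
  simp only [TensorProduct.smul_tmul]
  abel

end Nuclearity

/-! ### The dual operator system of the span of a frame -/

section DualSystem

variable {S : Type*} [AddCommGroup S] [Module ℂ S] [StarAddMonoid S] [StarModule ℂ S]
  [OperatorSystem S]

namespace Frame

variable {κ : Type*} [Fintype κ] [DecidableEq κ]

/-- Change of the index set of a frame. -/
def reindex {κ' : Type*} [Fintype κ'] [DecidableEq κ'] (B : Frame S κ) (g : κ' ≃ κ) :
    Frame S κ' where
  e m := B.e (g m)
  f m := B.f (g m)
  star_e m := B.star_e _
  isState_f m := B.isState_f _
  f_e l m := by simp [B.f_e]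
  sum_e := by rw [g.sum_comp B.e, B.sum_e]

variable (B : Frame S κ)

/-- The matrix `c` of functionals on the span of the frame has a completely positive extension. -/
def HasCPExtension {n : ℕ} (c : Matrix (Fin n) (Fin n) (κ → ℂ)) : Prop :=
  ∃ φ : S →ₗ[ℂ] Matrix (Fin n) (Fin n) ℂ, IsCP φ ∧ ∀ m i j, φ (B.e m) i j = c i j m

variable {B}

theorem HasCPExtension.add {n : ℕ} {c c' : Matrix (Fin n) (Fin n) (κ → ℂ)}
    (h : B.HasCPExtension c) (h' : B.HasCPExtension c') : B.HasCPExtension (c + c') := by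
  obtain ⟨φ, hφ, h1⟩ := h
  obtain ⟨φ', hφ', h2⟩ := h'
  exact ⟨φ + φ', hφ.add hφ', fun m i j => by simp [h1, h2]⟩

theorem HasCPExtension.smul {n : ℕ} {c : Matrix (Fin n) (Fin n) (κ → ℂ)}
    (h : B.HasCPExtension c) {r : ℝ} (hr : 0 ≤ r) : B.HasCPExtension ((r : ℂ) • c) := by
  obtain ⟨φ, hφ, h1⟩ := h
  exact ⟨(r : ℂ) • φ, hφ.smul hr, fun m i j => by simp [h1]⟩

theorem HasCPExtension.matConj {n k : ℕ} {c : Matrix (Fin n) (Fin n) (κ → ℂ)}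
    (h : B.HasCPExtension c) (α : Matrix (Fin k) (Fin n) ℂ) :
    B.HasCPExtension (_root_.matConj α c) := by
  obtain ⟨φ, hφ, h1⟩ := h
  refine ⟨congr α ∘ₗ φ, (isCP_congr α).comp hφ, fun m i j => ?_⟩
  rw [LinearMap.comp_apply, congr_apply, ← matConj_eq_mul]
  simp [matConj_apply, h1]

/-- The map `∑ f_m(·) c(m)` is an extension by biorthogonality. Applied to multiples of the unit and
to differences from them, it provides the order unit property. -/
theorem hasCPExtension_of_posSemidef {n : ℕ} {c : Matrix (Fin n) (Fin n) (κ → ℂ)}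
    (h : ∀ m, (c.map fun x => x m).PosSemidef) : B.HasCPExtension c :=
  ⟨∑ m, (B.f m).smulRight (c.map fun x => x m),
    isCP_sum _ fun m _ => (B.isState_f m).isCP_smulRight (h m), fun m i j => by
      simp only [LinearMap.sum_apply, LinearMap.smulRight_apply, Matrix.sum_apply,
        Matrix.smul_apply, B.f_e]
      simp⟩

theorem posSemidef_map_diagonal {κ : Type*} {n : ℕ} {r : ℝ} (hr : 0 ≤ r) (m : κ) :
    ((Matrix.diagonal fun _ : Fin n => (r : ℂ) • (1 : κ → ℂ)).map fun x => x m).PosSemidef := by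
  rw [Matrix.diagonal_map rfl]
  exact Matrix.PosSemidef.diagonal fun i => by simpa using hr

theorem hasCPExtension_diagonal {n : ℕ} {r : ℝ} (hr : 0 ≤ r) :
    B.HasCPExtension (Matrix.diagonal fun _ : Fin n => (r : ℂ) • (1 : κ → ℂ)) :=
  hasCPExtension_of_posSemidef (posSemidef_map_diagonal hr)

variable (B) in
/-- The matrices of functionals that are limits of those with a completely positive extension. -/
def dualCone (n : ℕ) : Set (Matrix (Fin n) (Fin n) (κ → ℂ)) :=
  {c | ∀ r : ℝ, 0 < r →
    B.HasCPExtension (c + Matrix.diagonal fun _ : Fin n => (r : ℂ) • (1 : κ → ℂ))}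

theorem HasCPExtension.mem_dualCone {n : ℕ} {c : Matrix (Fin n) (Fin n) (κ → ℂ)}
    (h : B.HasCPExtension c) : c ∈ B.dualCone n :=
  fun _ hr => h.add (hasCPExtension_diagonal hr.le)

theorem diagonal_add_diagonal {κ : Type*} {n : ℕ} (r s : ℝ) :
    (Matrix.diagonal fun _ : Fin n => ((r + s : ℝ) : ℂ) • (1 : κ → ℂ)) =
      (Matrix.diagonal fun _ : Fin n => (r : ℂ) • (1 : κ → ℂ)) +
        Matrix.diagonal fun _ : Fin n => (s : ℂ) • (1 : κ → ℂ) := by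
  rw [Matrix.diagonal_add, Complex.ofReal_add]
  simp only [add_smul]

theorem smul_diagonal {κ : Type*} {n : ℕ} (r s : ℝ) :
    (Matrix.diagonal fun _ : Fin n => ((r * s : ℝ) : ℂ) • (1 : κ → ℂ)) =
      (r : ℂ) • Matrix.diagonal fun _ : Fin n => (s : ℂ) • (1 : κ → ℂ) := by
  rw [← Matrix.diagonal_smul, Complex.ofReal_mul]
  congr 1
  ext1 i
  exact mul_smul _ _ _

theorem dualCone_add {n : ℕ} {c c' : Matrix (Fin n) (Fin n) (κ → ℂ)} (h : c ∈ B.dualCone n)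
    (h' : c' ∈ B.dualCone n) : c + c' ∈ B.dualCone n := fun r hr => by
  convert (h (r / 2) (half_pos hr)).add (h' (r / 2) (half_pos hr)) using 1
  nth_rewrite 1 [← add_halves r]
  rw [diagonal_add_diagonal]
  abel

theorem dualCone_smul {n : ℕ} {c : Matrix (Fin n) (Fin n) (κ → ℂ)} {t : ℝ} (ht : 0 ≤ t)
    (h : c ∈ B.dualCone n) : (t : ℂ) • c ∈ B.dualCone n := fun r hr => by
  rcases ht.eq_or_lt with rfl | ht
  · simpa only [Complex.ofReal_zero, zero_smul, zero_add] using hasCPExtension_diagonal hr.le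
  · convert (h (r / t) (div_pos hr ht)).smul ht.le using 1
    rw [smul_add, ← smul_diagonal, mul_div_cancel₀ _ ht.ne']

/-- Congruence does not preserve multiples of the unit. If `s` bounds `αα*`, perturbing `c` by `r /
s` leaves the defect `r - (r / s) αα*`, which is positive semidefinite in every coordinate and hence
extends. -/
theorem dualCone_matConj {n k : ℕ} (α : Matrix (Fin k) (Fin n) ℂ)
    {c : Matrix (Fin n) (Fin n) (κ → ℂ)} (h : c ∈ B.dualCone n) :
    matConj α c ∈ B.dualCone k := fun r hr => by
  obtain ⟨s, hs, h1⟩ := exists_smul_one_sub_posSemidef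
    (Matrix.isHermitian_mul_conjTranspose_self α)
  have h2 : B.HasCPExtension ((Matrix.diagonal fun _ : Fin k => (r : ℂ) • (1 : κ → ℂ)) -
      matConj α (Matrix.diagonal fun _ : Fin n => ((r / s : ℝ) : ℂ) • (1 : κ → ℂ))) := by
    refine hasCPExtension_of_posSemidef fun m => ?_
    convert h1.smul (a := ((r / s : ℝ) : ℂ)) (by exact_mod_cast (div_pos hr hs).le) using 1
    have hs' : (s : ℂ) ≠ 0 := by exact_mod_cast hs.ne'
    ext i j
    rw [Matrix.map_apply, Matrix.sub_apply, matConj_diagonal]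
    by_cases hij : i = j
    · simp [hij]
      field_simp
    · simp [hij, mul_comm]
  convert ((h (r / s) (div_pos hr hs)).matConj α).add h2 using 1
  rw [matConj_add]
  abel

theorem dualCone_isHermitian {n : ℕ} {c : Matrix (Fin n) (Fin n) (κ → ℂ)}
    (h : c ∈ B.dualCone n) : c.conjTranspose = c := by
  obtain ⟨φ, hφ, h1⟩ := h 1 one_pos
  ext i j m
  have h2 := congrFun (congrFun (hφ.map_star (B.e m)) i) j
  rw [B.star_e, Matrix.star_apply, h1, h1] at h2
  by_cases hij : i = j
  · subst hij
    simpa using h2.symm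
  · simpa [hij, Ne.symm hij] using h2.symm

/-- The core of properness. Extensions `φ`, `φ'` of perturbations of `c` and `-c` are applied to the
positive elements `t1 - e_m` and `t1 + e_m`. In the sum the contributions of `c` at the unit cancel,
leaving `-2c(m)` plus an error of order `s`. -/
theorem posSemidef_neg_of_mem_dualCone {n : ℕ} {c : Matrix (Fin n) (Fin n) (κ → ℂ)}
    (h : c ∈ B.dualCone n) (h' : -c ∈ B.dualCone n) (m : κ) :
    (-c.map fun x => x m).PosSemidef := by
  obtain ⟨t, ht, hb⟩ := exists_isBound (B.e m)
  have hp := hb.isPos_sub (B.star_e m)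
  have hp' := (hb.smul (-1)).isPos_sub (by rw [neg_one_smul, star_neg, B.star_e])
  rw [norm_neg, norm_one, one_mul, neg_one_smul, sub_neg_eq_add] at hp'
  refine posSemidef_of_forall_smul_one_add fun r hr => ?_
  set d : ℝ := (Fintype.card κ : ℝ)
  have hd : 0 < t * d + 1 := by positivity
  -- Half of the sum above is `t d s - c(m)`; adding a further `s` gives exactly `r - c(m)`.
  set s := r / (t * d + 1) with hs
  have hs0 : 0 < s := div_pos hr hd
  have hrs : r = t * d * s + s := by
    rw [hs]
    field_simp
  obtain ⟨φ, hφ, h1⟩ := h s hs0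
  obtain ⟨φ', hφ', h2⟩ := h' s hs0
  have e1 := isPos_matrix.mp (hφ.isPos hp)
  have e2 := isPos_matrix.mp (hφ'.isPos hp')
  have e3 : ((s : ℂ) • (1 : Matrix (Fin n) (Fin n) ℂ)).PosSemidef :=
    Matrix.PosSemidef.one.smul (by exact_mod_cast hs0.le)
  have e4 := ((e1.add e2).smul (a := (1 / 2 : ℂ)) (by
    rw [Complex.le_def]; norm_num)).add e3
  convert e4 using 1
  rw [← B.sum_e, hrs]
  ext i j
  simp only [map_sub, map_add, map_smul, map_sum, Matrix.add_apply, Matrix.sub_apply,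
    Matrix.smul_apply, Matrix.sum_apply, h1, h2, Matrix.neg_apply, Matrix.map_apply,
    Pi.add_apply, Pi.neg_apply, smul_eq_mul, Finset.sum_add_distrib, Finset.sum_neg_distrib]
  by_cases hij : i = j
  · subst hij
    simp [d]
    ring
  · simp [hij]
    ring

variable (B) in
/-- The dual operator system of the span of a frame, in the coordinates given by the states of the
frame. -/
@[reducible] def dualSystem : OperatorSystem (κ → ℂ) where
  cone n := B.dualCone n
  unit := 1
  cone_isHermitian h := dualCone_isHermitian h
  zero_mem n := HasCPExtension.mem_dualCone ⟨0, isCP_zero, fun m i j => rfl⟩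
  add_mem := dualCone_add
  smul_mem := dualCone_smul
  proper {n c} h h' := by
    open scoped MatrixOrder in
    have key : ∀ m, (c.map fun x => x m) = 0 := fun m => by
      have h1 := posSemidef_neg_of_mem_dualCone h h' m
      have h2 := posSemidef_neg_of_mem_dualCone h' (by rwa [neg_neg]) m
      refine le_antisymm (by simpa [Matrix.le_iff] using h1) ?_
      rw [Matrix.nonneg_iff_posSemidef]
      have h3 : (c.map fun x => x m) = -(-c).map fun x => x m := by
        ext i j
        simp
      rw [h3]
      exact h2
    ext i j m
    exact congrFun (congrFun (key m) i) j
  conj_mem α _ h := dualCone_matConj α h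
  star_unit := star_one _
  orderUnit {n c} hc := by
    have hH : ∀ m, (c.map fun x => x m).IsHermitian := fun m => by
      ext i j
      exact congrFun (congrFun (congrFun hc i) j) m
    choose r hr h using fun m => exists_smul_one_sub_posSemidef (hH m)
    refine ⟨∑ m, r m + 1, add_pos_of_nonneg_of_pos (Finset.sum_nonneg fun m _ => (hr m).le)
      one_pos, HasCPExtension.mem_dualCone (hasCPExtension_of_posSemidef fun m => ?_)⟩
    have h1 : 0 ≤ ∑ m, r m + 1 - r m := by
      have := Finset.single_le_sum (fun m _ => (hr m).le) (Finset.mem_univ m)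
      linarith
    convert (h m).add (Matrix.PosSemidef.one.smul (a := ((∑ m, r m + 1 - r m : ℝ) : ℂ))
      (by exact_mod_cast h1)) using 1
    ext i j
    by_cases hij : i = j
    · simp [hij]
    · simp [hij]
  archimedean {n c} h r hr := by
    convert h (r / 2) (half_pos hr) (r / 2) (half_pos hr) using 1
    nth_rewrite 1 [← add_halves r]
    rw [diagonal_add_diagonal]
    abel

variable (B) in
/-- The tensor in `E* ⊗ S` that corresponds to the inclusion map of the span `E` of a frame. -/
noncomputable def inclusionTensor : (κ → ℂ) ⊗[ℂ] S := ∑ m, Pi.single m 1 ⊗ₜ B.e m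

/-- `∑ φ(δ_m) ⊗ ψ(e_m)` is, up to a flip, the amplification of `φ` applied to the restriction of
`ψ`. That restriction is positive in the dual, as `ψ` extends it. -/
theorem inclusionTensor_mem_minCone : letI := B.dualSystem
    (Matrix.of fun _ _ : Fin 1 => B.inclusionTensor) ∈ minCone (κ → ℂ) S 1 := by
  let := B.dualSystem
  intro k l φ ψ hφ hψ
  have h1 : (Matrix.of fun i j : Fin l => fun m => ψ (B.e m) i j) ∈ cone (S := κ → ℂ) l :=
    HasCPExtension.mem_dualCone ⟨ψ, hψ.isCP, fun m i j => rfl⟩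
  convert (mem_cone_matrix.mp (hφ.map_cone l _ h1)).submatrix
    (fun p : Fin 1 × (Fin k × Fin l) => (p.2.2, p.2.1)) using 1
  ext ⟨i, a, b⟩ ⟨j, a', b'⟩
  simp only [Matrix.comp_apply, Matrix.map_apply, Matrix.of_apply, Matrix.submatrix_apply,
    inclusionTensor, map_sum, mapTensor_tmul, Matrix.sum_apply, Matrix.kroneckerMap_apply]
  rw [LinearMap.pi_apply_eq_sum_univ φ]
  simp only [Matrix.sum_apply, Matrix.smul_apply, smul_eq_mul]
  refine Finset.sum_congr rfl fun m _ => ?_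
  have h2 : (fun j => if m = j then (1 : ℂ) else 0) = Pi.single m 1 := by
    ext x
    simp [Pi.single_apply, eq_comm]
  rw [mul_comm, h2]

end Frame

end DualSystem

/-! ### From dual systems to approximate factorizations -/

section Factorization

variable {S : Type u} [AddCommGroup S] [Module ℂ S] [StarAddMonoid S] [StarModule ℂ S]
  [OperatorSystem S]

/-- The map `M_k → S` with matrix of values `W` on the matrix units. -/
def ofChoi {S : Type*} [AddCommGroup S] [Module ℂ S] {k : ℕ} (W : Matrix (Fin k) (Fin k) S) : Matrix (Fin k) (Fin k) ℂ →ₗ[ℂ] S where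
  toFun A := ∑ i, ∑ j, A i j • W i j
  map_add' A A' := by simp [add_smul, Finset.sum_add_distrib]
  map_smul' c A := by simp [mul_smul, Finset.smul_sum]

theorem ofChoi_apply {S : Type*} [AddCommGroup S] [Module ℂ S] {k : ℕ} (W : Matrix (Fin k) (Fin k) S) (A : Matrix (Fin k) (Fin k) ℂ) :
    ofChoi W A = ∑ i, ∑ j, A i j • W i j := rfl

/-- Choi's criterion for complete positivity. -/
theorem isCP_ofChoi {k : ℕ} {W : Matrix (Fin k) (Fin k) S} (hW : W ∈ cone k) :
    IsCP (ofChoi W) := fun n A hA => by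
  open scoped MatrixOrder in
  obtain ⟨C, hC⟩ := CStarAlgebra.nonneg_iff_eq_star_mul_self.mp (mem_cone_matrix.mp hA).nonneg
  -- Writing the positive matrix as `C*C` decomposes it into rank-one terms, each of which
  -- contributes a congruence of `W`.
  have h : A.map (ofChoi W) = ∑ t, matConj (Matrix.of fun p i => star (C t (p, i))) W := by
    ext p q
    have h1 : ∀ i j, A p q i j = ∑ t, star (C t (p, i)) * C t (q, j) := fun i j => by
      have := congrFun (congrFun hC (p, i)) (q, j)
      rw [Matrix.mul_apply] at this
      exact this
    simp only [Matrix.map_apply, ofChoi_apply, h1, Matrix.sum_apply, matConj_apply,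
      Matrix.of_apply, star_star, Finset.sum_smul]
    conv_rhs => rw [Finset.sum_comm]
    refine Finset.sum_congr rfl fun i _ => ?_
    rw [Finset.sum_comm]
  rw [h]
  exact sum_mem _ fun t _ => conj_mem _ hW

/-- Correction of a completely positive factorization of a small perturbation of the identity to a
unital one. -/
theorem exists_isUCP_factorization (hu : (unit : S) ≠ 0) {k : ℕ}
    {φ : S →ₗ[ℂ] Matrix (Fin k) (Fin k) ℂ} {ψ : Matrix (Fin k) (Fin k) ℂ →ₗ[ℂ] S} (hφ : IsCP φ)
    (hψ : IsCP ψ) (hpd : (φ unit).PosDef) {f : S →ₗ[ℂ] ℂ} (hf : IsState f) {p : S} (hp : IsPos p)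
    {η : ℝ} (hη : 0 < η) (hpη : IsPos ((η : ℂ) • unit - p)) (hunit : ψ (φ unit) = unit + p) :
    ∃ (φ' : S →ₗ[ℂ] Matrix (Fin k) (Fin k) ℂ) (ψ' : Matrix (Fin k) (Fin k) ℂ →ₗ[ℂ] S),
      IsUCP φ' ∧ IsUCP ψ' ∧ ∀ x, ψ (φ x) = x + f x • p →
        ∀ t : ℝ, 0 ≤ t → IsBound t x → osNorm (ψ' (φ' x) - x) ≤ 3 * η * t := by
  -- A diagonal entry serves as a state of `M_k` below; `k = 0` would force `1 + p = 0`.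
  obtain ⟨i⟩ : Nonempty (Fin k) := by
    by_contra hk
    rw [not_nonempty_iff] at hk
    rw [Subsingleton.elim (φ unit) 0, map_zero] at hunit
    refine hu (eq_zero_of_isPos_neg isPos_unit ?_)
    rwa [neg_eq_of_add_eq_zero_right hunit.symm]
  obtain ⟨B, C, hCB, hφ'⟩ := hφ.exists_isUCP_congr hpd
  have hτ : IsState (Matrix.entryLinearMap ℂ ℂ i i :
      Matrix (Fin k) (Fin k) ℂ →ₗ[ℂ] ℂ) :=
    (IsUCP.isState (φ := LinearMap.id) ⟨rfl, fun n X hX => hX⟩ i)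
  set τ : Matrix (Fin k) (Fin k) ℂ →ₗ[ℂ] ℂ := Matrix.entryLinearMap ℂ ℂ i i
  have hcomp : ∀ x, (ψ ∘ₗ congr C) ((congr B ∘ₗ φ) x) = ψ (φ x) := fun x => by
    simp only [LinearMap.comp_apply, congr_congr, hCB, congr_one]
  have hη' : 0 ≤ (1 + η)⁻¹ := by positivity
  have hη1 : ((1 + η : ℝ) : ℂ) ≠ 0 := by
    have : (1 + η) ≠ 0 := by positivity
    exact_mod_cast this
  -- Adding `τ(·) q` raises the value at the unit from `1 + p` to `(1 + η)1`, so a scalar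
  -- normalization suffices, with no inverse in S.
  set q := (η : ℂ) • unit - p with hq
  refine ⟨congr B ∘ₗ φ, (((1 + η)⁻¹ : ℝ) : ℂ) • (ψ ∘ₗ congr C + τ.smulRight q), hφ',
    ⟨?_, (((hψ.comp (isCP_congr C)).add (hτ.isCP_smulRight_isPos hpη)).smul hη')⟩, ?_⟩
  · rw [LinearMap.smul_apply, LinearMap.add_apply, LinearMap.smulRight_apply, hτ.map_unit, one_smul,
      ← hφ'.map_unit, hcomp, hunit, hq]
    have : (unit : S) + p + ((η : ℂ) • unit - p) = ((1 + η : ℝ) : ℂ) • unit := by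
      push_cast
      module
    rw [this, smul_smul, Complex.ofReal_inv, inv_mul_cancel₀ hη1, one_smul]
  · intro x hx t ht hb
    have hp' : IsBound η p := isBound_of_isPos ((isPos_unit.smul hη.le).add hp) hpη
    have hq' : IsBound η q := isBound_of_isPos ((isPos_unit.smul hη.le).add hpη) (by
      rwa [hq, sub_sub_cancel])
    have h1 := hb.smul (-(η : ℂ))
    have h2 := (hp'.smul (f x)).mono (mul_le_mul_of_nonneg_right (hf.norm_le ht hb) hη.le)
    have h3 := (hq'.smul (τ ((congr B ∘ₗ φ) x))).mono
      (mul_le_mul_of_nonneg_right ((hφ'.isState i).norm_le ht hb) hη.le)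
    have h4 := ((h1.add h2).add h3).smul (((1 + η)⁻¹ : ℝ) : ℂ)
    -- Before normalization the error is `-ηx + f(x)p + τ(φ'x)q`. Each of its three terms is bounded
    -- by `ηt`.
    have h5 : ((((1 + η)⁻¹ : ℝ) : ℂ) • (ψ ∘ₗ congr C + τ.smulRight q)) ((congr B ∘ₗ φ) x) - x =
        (((1 + η)⁻¹ : ℝ) : ℂ) • (-(η : ℂ) • x + f x • p + τ ((congr B ∘ₗ φ) x) • q) := by
      rw [LinearMap.smul_apply, LinearMap.add_apply, hcomp, hx, LinearMap.smulRight_apply]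
      have h6 : x = (((1 + η)⁻¹ : ℝ) : ℂ) • (((1 + η : ℝ) : ℂ) • x) := by
        rw [smul_smul, Complex.ofReal_inv, inv_mul_cancel₀ hη1, one_smul]
      generalize τ ((congr B ∘ₗ φ) x) • q = y
      calc (((1 + η)⁻¹ : ℝ) : ℂ) • (x + f x • p + y) - x
          = (((1 + η)⁻¹ : ℝ) : ℂ) • (x + f x • p + y) -
              (((1 + η)⁻¹ : ℝ) : ℂ) • (((1 + η : ℝ) : ℂ) • x) := by rw [← h6]
        _ = _ := by
          rw [← smul_sub]
          congr 1
          push_cast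
          module
    rw [h5]
    refine (h4.mono ?_).osNorm_le (by positivity)
    rw [norm_neg, Complex.norm_real, Complex.norm_real, Real.norm_of_nonneg hη.le,
      Real.norm_of_nonneg hη', show η * t + t * η + t * η = 3 * η * t by ring]
    refine mul_le_of_le_one_left (by positivity) (inv_le_one_of_one_le₀ (by linarith))

variable {κ : Type*} [Fintype κ] [DecidableEq κ]

/-- Max-positivity of the perturbed inclusion tensor, read in the coordinate `m`: `P` gives the
values of a map into `M_k`, and `W` is the Choi matrix of a map back to S. -/
theorem Frame.exists_choi_factorization {B : Frame S κ}
    (h : letI := B.dualSystem; MinEqMax (κ → ℂ) S) {ε : ℝ} (hε : 0 < ε) :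
    ∃ (k : ℕ) (P : Matrix (Fin k) (Fin k) (κ → ℂ)) (W : Matrix (Fin k) (Fin k) S),
      P ∈ B.dualCone k ∧ W ∈ cone k ∧ ∀ m, ∑ i, ∑ j, P i j m • W i j = B.e m + (ε : ℂ) • unit := by
  let := B.dualSystem
  have h1 := B.inclusionTensor_mem_minCone
  rw [h 1] at h1
  obtain ⟨k, l, P, Q, α, hP, hQ, heq⟩ := h1 ε hε
  -- At level 1 the scalar matrix is a single row of length `kl`; reshaped to `k × l`, it compresses
  -- `Q` to size `k`.
  refine ⟨k, P, matConj (Matrix.of fun i a => α 0 (i, a)) Q, hP, conj_mem _ hQ, fun m => ?_⟩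
  have h2 := congrArg (slice S (LinearMap.proj m)) (congrFun (congrFun heq 0) 0)
  have h3 : (unit : κ → ℂ) m = 1 := rfl
  simp only [Matrix.add_apply, Matrix.of_apply, Matrix.diagonal_apply_eq, map_add, map_smul,
    slice_tmul, LinearMap.proj_apply, h3, one_smul, Frame.inclusionTensor, map_sum,
    Pi.single_apply, ite_smul, zero_smul, Finset.sum_ite_eq, Finset.mem_univ, if_true,
    matConj_apply, Matrix.kroneckerMap_apply, Fintype.sum_prod_type] at h2
  rw [h2]
  refine Finset.sum_congr rfl fun i _ => ?_
  rw [Finset.sum_comm]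
  refine Finset.sum_congr rfl fun j _ => ?_
  rw [matConj_apply, Finset.smul_sum]
  refine Finset.sum_congr rfl fun a _ => ?_
  rw [Finset.smul_sum]
  refine Finset.sum_congr rfl fun b _ => ?_
  simp only [smul_smul, Matrix.of_apply]
  rw [mul_comm]

theorem Frame.exists_isUCP_approx {B : Frame S κ}
    (h : letI := B.dualSystem; MinEqMax (κ → ℂ) S) (hu : (unit : S) ≠ 0) {η : ℝ} (hη : 0 < η) :
    ∃ (k : ℕ) (φ : S →ₗ[ℂ] Matrix (Fin k) (Fin k) ℂ) (ψ : Matrix (Fin k) (Fin k) ℂ →ₗ[ℂ] S),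
      IsUCP φ ∧ IsUCP ψ ∧ ∀ x, ∑ m, B.f m x • B.e m = x →
        ∀ t : ℝ, 0 ≤ t → IsBound t x → osNorm (ψ (φ x) - x) ≤ 3 * η * t := by
  set d : ℝ := (Fintype.card κ : ℝ) with hd
  have hd0 : 0 < d := by
    rw [hd, Nat.cast_pos, Fintype.card_pos_iff]
    by_contra hκ
    rw [not_nonempty_iff] at hκ
    exact hu (by rw [← B.sum_e, Finset.univ_eq_empty, Finset.sum_empty])
  have hdc : (d : ℂ) ≠ 0 := by exact_mod_cast hd0.ne'
  obtain ⟨k, P, W, hP, hW, hPW⟩ := Frame.exists_choi_factorization h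
    (ε := η / (2 * d)) (by positivity)
  have hψ := isCP_ofChoi hW
  have hw : IsPos (ofChoi W 1) := hψ.isPos isPos_unit
  obtain ⟨R, hR, hwR⟩ := exists_isPos_sub hw.star_eq
  -- `P` extends only after adding `r`. This `r` keeps `2 d r ofChoi W 1` below `η / 2`; the other
  -- half of `η` is `d` times the perturbation `η / (2d)` of the inclusion.
  set r := η / (4 * d * R) with hr
  have hr0 : 0 < r := by positivity
  obtain ⟨φ₀, hφ₀, hφP⟩ := hP r hr0
  set f : S →ₗ[ℂ] ℂ := ((d⁻¹ : ℝ) : ℂ) • ∑ m, B.f m with hf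
  have hfs : IsState f := by
    refine ⟨?_, fun n X hX => ?_⟩
    · have h1 : (Fintype.card κ : ℂ) = (d : ℂ) := by rw [hd, Complex.ofReal_natCast]
      simp only [hf, LinearMap.smul_apply, LinearMap.sum_apply,
        fun m => (B.isState_f m).map_unit, Finset.sum_const, Finset.card_univ, nsmul_eq_mul,
        mul_one, smul_eq_mul, h1]
      rw [Complex.ofReal_inv, inv_mul_cancel₀ hdc]
    · have h1 : X.map f = ((d⁻¹ : ℝ) : ℂ) • ∑ m, X.map (B.f m) := by
        ext i j
        simp [hf, Matrix.sum_apply]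
      rw [h1]
      refine (Matrix.posSemidef_sum _ fun m _ => (B.isState_f m).map_cone n X hX).smul ?_
      exact_mod_cast (inv_pos.mpr hd0).le
  have hH : ((r * d : ℝ) : ℂ) • (1 : Matrix (Fin k) (Fin k) ℂ) |>.PosSemidef :=
    Matrix.PosSemidef.one.smul (by exact_mod_cast (mul_pos hr0 hd0).le)
  -- The averaged state `f` is `1 / d` at every `e_m`. The added term makes `φ 1` positive definite
  -- and shifts each `φ₀(e_m)` by another `r`, so the total perturbation is `f(x) p` on the whole
  -- span.
  set φ := φ₀ + f.smulRight (((r * d : ℝ) : ℂ) • (1 : Matrix (Fin k) (Fin k) ℂ)) with hφ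
  have hφcp : IsCP φ := hφ₀.add (hfs.isCP_smulRight hH)
  set p : S := ((d : ℝ) : ℂ) • (((η / (2 * d) : ℝ) : ℂ) • unit + ((2 * r : ℝ) : ℂ) • ofChoi W 1)
    with hp
  have hpp : IsPos p := ((isPos_unit.smul (by positivity)).add (hw.smul (by positivity))).smul hd0.le
  have hpη : IsPos ((η : ℂ) • unit - p) := by
    convert hwR.smul (r := 2 * r * d) (by positivity) using 1
    have hRc : (R : ℂ) ≠ 0 := by exact_mod_cast hR.ne'
    rw [hp, hr]
    push_cast
    simp only [smul_sub, smul_add, smul_smul]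
    have e1 : (d : ℂ) * (η / (2 * d)) = η / 2 := by field_simp
    have e2 : (2 * ((η : ℂ) / (4 * d * R)) * d * R) = η / 2 := by field_simp; norm_num
    have e3 : (d : ℂ) * (2 * (η / (4 * d * R))) = 2 * (η / (4 * d * R)) * d := by ring
    rw [e1, e2, e3]
    module
  have hpd : (φ unit).PosDef := by
    have := posDef_add_smul_one (isPos_matrix.mp (hφ₀.isPos isPos_unit)) (mul_pos hr0 hd0)
    rw [hφ, LinearMap.add_apply, LinearMap.smulRight_apply, hfs.map_unit, one_smul]
    exact this
  have hfe : ∀ m, f (B.e m) = ((d⁻¹ : ℝ) : ℂ) := fun m => by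
    simp [hf, B.f_e]
  have hmain : ∀ m, ofChoi W (φ (B.e m)) = B.e m + f (B.e m) • p := fun m => by
    have h1 : φ₀ (B.e m) = (P.map fun x => x m) + (r : ℂ) • 1 := by
      ext i j
      rw [hφP]
      by_cases hij : i = j <;> simp [hij]
    have h2 : ofChoi W (P.map fun x => x m) = B.e m + ((η / (2 * d) : ℝ) : ℂ) • unit := hPW m
    rw [hφ, LinearMap.add_apply, h1, LinearMap.smulRight_apply, hfe, map_add, map_add, h2, map_smul,
      map_smul, map_smul, hp]
    have e1 : ((d⁻¹ : ℝ) : ℂ) * ((r * d : ℝ) : ℂ) = r := by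
      push_cast
      field_simp
    have e2 : ((d⁻¹ : ℝ) : ℂ) * (d : ℂ) = 1 := by
      push_cast
      exact inv_mul_cancel₀ hdc
    rw [smul_smul, e1, smul_smul, e2]
    push_cast
    module
  have hexp : ∀ x, ∑ m, B.f m x • B.e m = x → ofChoi W (φ x) = x + f x • p := fun x hx => by
    rw [← hx]
    simp only [map_sum, map_smul, hmain, smul_add, Finset.sum_add_distrib, Finset.sum_smul,
      smul_smul, smul_eq_mul]
  obtain ⟨φ', ψ', h1, h2, h3⟩ := exists_isUCP_factorization hu hφcp hψ hpd hfs hpp hη hpη (by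
    rw [hexp unit (by simp [fun m => (B.isState_f m).map_unit, B.sum_e]), hfs.map_unit, one_smul])
  exact ⟨k, φ', ψ', h1, h2, fun x hx => h3 x (hexp x hx)⟩

theorem exists_isUCP_of_unit_eq_zero (hu : (unit : S) = 0) :
    ∃ (k : ℕ) (φ : S →ₗ[ℂ] Matrix (Fin k) (Fin k) ℂ) (ψ : Matrix (Fin k) (Fin k) ℂ →ₗ[ℂ] S),
      IsUCP φ ∧ IsUCP ψ := by
  refine ⟨0, 0, 0, ⟨Subsingleton.elim _ _, isCP_zero⟩, ⟨?_, isCP_zero⟩⟩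
  rw [LinearMap.zero_apply, hu]

theorem exists_isUCP_approx
    (h : ∀ (d : ℕ) (B : Frame S (ULift.{v} (Fin d))),
      letI := B.dualSystem; MinEqMax (ULift.{v} (Fin d) → ℂ) S) (F : Finset S) {η : ℝ}
    (hη : 0 < η) :
    ∃ (k : ℕ) (φ : S →ₗ[ℂ] Matrix (Fin k) (Fin k) ℂ) (ψ : Matrix (Fin k) (Fin k) ℂ →ₗ[ℂ] S),
      IsUCP φ ∧ IsUCP ψ ∧ ∀ x ∈ F, osNorm (ψ (φ x) - x) ≤ η := by
  by_cases hu : (unit : S) = 0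
  · obtain ⟨k, φ, ψ, hφ, hψ⟩ := exists_isUCP_of_unit_eq_zero hu
    refine ⟨k, φ, ψ, hφ, hψ, fun x _ => ?_⟩
    rw [eq_zero_of_unit_eq_zero hu (ψ (φ x) - x)]
    exact (isBound_zero.osNorm_le le_rfl).trans hη.le
  · obtain ⟨d, B, hB⟩ := exists_frame F
    choose t ht hb using fun x : S => exists_isBound x
    -- A common norm bound for `F`; the tolerance `η / (3R)` turns the estimate `3ηt` into `η`.
    set R := ∑ x ∈ F, t x + 1
    have hR : 0 < R := add_pos_of_nonneg_of_pos (Finset.sum_nonneg fun x _ => (ht x).le) one_pos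
    obtain ⟨k, φ, ψ, hφ, hψ, H⟩ := (B.reindex Equiv.ulift.{v}).exists_isUCP_approx
      (h d _) hu (η := η / (3 * R)) (by positivity)
    refine ⟨k, φ, ψ, hφ, hψ, fun x hx => ?_⟩
    have h1 : t x ≤ R := (Finset.single_le_sum (fun x _ => (ht x).le) hx).trans (by linarith)
    refine (H x ((Equiv.ulift.sum_comp fun m => B.f m x • B.e m).trans (hB x hx)) R hR.le
      ((hb x).mono h1)).trans (le_of_eq ?_)
    field_simp

/-- The net is indexed by a finite set to approximate on and a tolerance `1 / (N + 1)`. Lifting the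
frame index lets the test systems live in any prescribed universe. -/
theorem factorsThroughMatrices_of_frames
    (h : ∀ (d : ℕ) (B : Frame S (ULift.{v} (Fin d))),
      letI := B.dualSystem; MinEqMax (ULift.{v} (Fin d) → ℂ) S) : FactorsThroughMatrices S := by
  classical
  choose k φ ψ hφ hψ H using fun i : Finset S × ℕ =>
    exists_isUCP_approx h i.1 (η := 1 / ((i.2 : ℝ) + 1)) (by positivity)
  refine ⟨Finset S × ℕ, inferInstance, inferInstance, inferInstance, k, φ, ψ, hφ, hψ, fun x => ?_⟩
  rw [Metric.tendsto_atTop]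
  intro ε hε
  obtain ⟨N, hN⟩ := exists_nat_one_div_lt hε
  refine ⟨({x}, N), fun i hi => ?_⟩
  rw [Real.dist_eq, sub_zero, abs_of_nonneg (osNorm_nonneg _)]
  refine (H i x (hi.1 (Finset.mem_singleton_self x))).trans_lt (lt_of_le_of_lt ?_ hN)
  exact one_div_le_one_div_of_le (by positivity) (by
    have : (N : ℝ) ≤ i.2 := by exact_mod_cast hi.2
    linarith)

end Factorization

end OperatorSystem

theorem corollary3p2 (S : Type u) [AddCommGroup S] [Module ℂ S] [StarAddMonoid S]
    [StarModule ℂ S] [OperatorSystem S] :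
    List.TFAE [
      OperatorSystem.IsNuclear.{u, v} S,
      ∀ (E : Type w) [AddCommGroup E] [Module ℂ E] [StarAddMonoid E] [StarModule ℂ E]
        [OperatorSystem E] [FiniteDimensional ℂ E], OperatorSystem.MinEqMax E S,
      OperatorSystem.FactorsThroughMatrices S] := by
  tfae_have 1 → 3 := fun h => by
    refine OperatorSystem.factorsThroughMatrices_of_frames.{u, v} fun d B => ?_
    let := B.dualSystem
    exact (h (ULift.{v} (Fin d) → ℂ)).symm
  tfae_have 2 → 3 := fun h => by
    refine OperatorSystem.factorsThroughMatrices_of_frames.{u, w} fun d B => ?_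
    let := B.dualSystem
    exact h (ULift.{w} (Fin d) → ℂ)
  tfae_have 3 → 1 := fun h T _ _ _ _ _ => h.minEqMax
  tfae_have 3 → 2 := fun h E _ _ _ _ _ _ => h.minEqMax.symm
  tfae_finish
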